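/- Let $\mathbf k$ be a field, $G$ a finite abelian group, $g_1,\dots,g_n\in G$, and $\chi_1,\dots,\chi_n\colon G\to\mathbf k^*$ characters with $\chi_i(g_i)\ne 1$ for all $i$ and $\chi_i(g_j)\chi_j(g_i)=1$ for $i\neq j$. Put $q_{ij}=\chi_j(g_i)$ and $m_i=\operatorname{ord}(q_{ii})$. Let $\lambda_i\in\mathbf k$ and $\lambda_{ij}\in\mathbf k$ ($i\ne j$) be such that $\lambda_i(\chi_i^{m_i}-1)=0$, $\lambda_{ij}(\chi_i\chi_j-1)=0$ and $\lambda_{ij}+q_{ij}\lambda_{ji}=0$ for $i\neq j$. Let $H=H(\mathbf g,\chi,\lambda)$ be the $\mathbf k$-algebra generated by the group $G$ and $x_1,\dots,x_n$, subject to the relations of $G$ and $$gx_i=\chi_i(g)x_ig,\qquad x_ix_j=q_{ij}x_jx_i+\lambda_{ij}(1-g_ig_j)\ (i\ne j),\qquad x_i^{m_i}=\lambda_i(1-g_i^{m_i}),$$ with the Hopf algebra structure given by $\Delta(g)=g\otimes g$, $\Delta(x_i)=g_i\otimes x_i+x_i\otimes 1$, $\varepsilon(g)=1$, $\varepsilon(x_i)=0$,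 $\mathcal S(g)=g^{-1}$, $\mathcal S(x_i)=-g_i^{-1}x_i$. Then there exist a nonzero right integral $\varphi\in H^*$ (that is, $\varphi(h_{(1)})f(h_{(2)})=f(1)\varphi(h)$ for all $f\in H^*$, $h\in H$), an algebra automorphism $\rho$ of $H$ with $\varphi(ba)=\varphi(\rho(a)b)$ for all $a,b\in H$ (the Nakayama automorphism), a nonzero right integral $t\in H$ (that is, $ta=\varepsilon(a)t$ for all $a\in H$) and an algebra map $\alpha\colon H\to\mathbf k$ with $at=\alpha(a)t$ for all $a\in H$ (the modular element). For every such choice of $\varphi,\rho,t,\alpha$, put $$L_1=\langle q_{11},\dots,q_{nn},\alpha(G)\rangle\ \supseteq\ L_2=\alpha(G)$$ (subgroups of $\mathbf k^*$) and $H_\omega=\{h\in H:\rho(h)=\omega h\}$ for $\omega\in L_1$. Then $H=\bigoplus_{\omega\in L_1}H_\omega$, and the following are equivalent: 1. the decomposition $H=\bigoplus_{\omega\in L_1}H_\omega$ is strongly graded, i.e. $H_\omega H_{\omega'}=H_{\omega\omega'}$ for all $\omega,\omega'\in L_1$; 2. each component $H_\omega$, $\omega\in L_1$, contains an element of $G$;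 3. $L_1=L_2$; 4. $H$ is a crossed product $H_1\ltimes\mathbf k L_1$, i.e. there are a weak action of $L_1$ on the algebra $H_1$ by algebra endomorphisms $b\mapsto\omega\cdot b$ (with $1\cdot b=b$), a normalized map $\sigma\colon L_1\times L_1\to H_1^\times$ with $(\omega\cdot(\omega'\cdot b))\,\sigma(\omega,\omega')=\sigma(\omega,\omega')\,(\omega\omega'\cdot b)$ and $(\omega\cdot\sigma(\omega',\omega''))\,\sigma(\omega,\omega'\omega'')=\sigma(\omega,\omega')\,\sigma(\omega\omega',\omega'')$, and an algebra isomorphism onto $H$ from $H_1\otimes\mathbf kL_1$ with product $(b\otimes\omega)(b'\otimes\omega')=b(\omega\cdot b')\sigma(\omega,\omega')\otimes\omega\omega'$, which is the inclusion on $H_1$ and maps $H_1\otimes\omega$ into $H_\omega$ for all $\omega\in L_1$. -/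

import Mathlib

open scoped TensorProduct

noncomputable section

namespace QLS

universe u v w

/-! ### Gaussian binomial coefficients (needed for the comultiplication to respect `x_i ^ m_i`) -/

/-- Gaussian binomial coefficients evaluated at `q`. -/
def gaussCoeff {k : Type u} [Field k] (q : k) : ℕ → ℕ → k
  | _, 0 => 1
  | 0, _ + 1 => 0
  | m + 1, j + 1 => gaussCoeff q m j + q ^ (j + 1) * gaussCoeff q m (j + 1)

theorem gaussCoeff_zero_right {k : Type u} [Field k] (q : k) (m : ℕ) :
    gaussCoeff q m 0 = 1 := by
  cases m <;> simp [gaussCoeff]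

theorem gaussCoeff_of_lt {k : Type u} [Field k] (q : k) (m : ℕ) :
    ∀ j, m < j → gaussCoeff q m j = 0 := by
  induction m with
  | zero => intro j hj; cases j with
    | zero => omega
    | succ j => simp [gaussCoeff]
  | succ m ih => intro j hj; cases j with
    | zero => omega
    | succ j => simp [gaussCoeff, ih j (by omega), ih (j + 1) (by omega)]

theorem gaussCoeff_self {k : Type u} [Field k] (q : k) (m : ℕ) : gaussCoeff q m m = 1 := by
  induction m with
  | zero => simp [gaussCoeff]
  | succ m ih => simp [gaussCoeff, ih, gaussCoeff_of_lt q m (m + 1) (by omega)]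

theorem gaussCoeff_aux {k : Type u} [Field k] (q : k) (m : ℕ) : ∀ j,
    (q ^ (j + 1) - 1) * gaussCoeff q (m + 1) (j + 1) = (q ^ (m + 1) - 1) * gaussCoeff q m j ∧
    (q ^ (m + 1) - q ^ j) * gaussCoeff q (m + 1) j
      = q ^ j * (q ^ (m + 1) - 1) * gaussCoeff q m j := by
  induction m with
  | zero =>
    intro j
    rcases j with _ | _ | j <;> simp [gaussCoeff]
  | succ m ih =>
    intro j
    constructor
    · have h1 := (ih j).1
      have h2 := (ih j).2
      rw [show gaussCoeff q (m + 1 + 1) (j + 1) = gaussCoeff q (m + 1) j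
        + q ^ (j + 1) * gaussCoeff q (m + 1) (j + 1) from rfl]
      linear_combination q ^ (j + 1) * h1 - q * h2
    · cases j with
      | zero => simp [gaussCoeff_zero_right]
      | succ j =>
        have h1 := (ih j).1
        have h2 := (ih j).2
        rw [show gaussCoeff q (m + 1 + 1) (j + 1) = gaussCoeff q (m + 1) j
          + q ^ (j + 1) * gaussCoeff q (m + 1) (j + 1) from rfl]
        linear_combination q * h2 - q ^ (j + 1) * h1

theorem gaussCoeff_eq_zero {k : Type u} [Field k] {q : k} {m : ℕ} (hq : IsPrimitiveRoot q m)
    {j : ℕ} (h0 : 0 < j) (hj : j < m) : gaussCoeff q m j = 0 := by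
  obtain ⟨m, rfl⟩ : ∃ l, m = l + 1 := ⟨m - 1, by omega⟩
  obtain ⟨j, rfl⟩ : ∃ l, j = l + 1 := ⟨j - 1, by omega⟩
  have h := (gaussCoeff_aux q m j).1
  rw [hq.pow_eq_one, sub_self, zero_mul] at h
  have hne : q ^ (j + 1) - 1 ≠ 0 := sub_ne_zero.mpr (hq.pow_ne_one_of_pos_of_lt (by omega) hj)
  exact (mul_eq_zero.mp h).resolve_left hne

section
variable {k : Type u} [Field k] {R : Type v} [Ring R] [Algebra k R]

theorem qcomm_pow {q : k} {a b : R} (h : b * a = q • (a * b)) (j : ℕ) :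
    b * a ^ j = q ^ j • (a ^ j * b) := by
  induction j with
  | zero => simp
  | succ j ih =>
    rw [pow_succ, ← mul_assoc, ih, smul_mul_assoc, mul_assoc, h, mul_smul_comm, smul_smul,
      ← mul_assoc, pow_succ]

theorem qbinomial {q : k} {a b : R} (h : b * a = q • (a * b)) (m : ℕ) :
    (a + b) ^ m = ∑ j ∈ Finset.range (m + 1), gaussCoeff q m j • (a ^ j * b ^ (m - j)) := by
  induction m with
  | zero => simp [gaussCoeff]
  | succ m ih =>
    rw [pow_succ', ih, add_mul, Finset.mul_sum, Finset.mul_sum]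
    rw [Finset.sum_range_succ' _ (m + 1)]
    have e1 : ∀ j ∈ Finset.range (m + 1),
        a * gaussCoeff q m j • (a ^ j * b ^ (m - j))
          = gaussCoeff q m j • (a ^ (j + 1) * b ^ (m + 1 - (j + 1))) := by
      intro j _
      rw [mul_smul_comm, ← mul_assoc, ← pow_succ', Nat.add_sub_add_right]
    have e2 : ∀ j ∈ Finset.range (m + 1),
        b * gaussCoeff q m j • (a ^ j * b ^ (m - j))
          = (q ^ j * gaussCoeff q m j) • (a ^ j * b ^ (m + 1 - j)) := by
      intro j hj
      have hj' : j ≤ m := by simpa [Nat.lt_succ_iff] using hj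
      rw [mul_smul_comm, ← mul_assoc, qcomm_pow h, smul_mul_assoc, smul_smul, mul_assoc,
        ← pow_succ', Nat.sub_add_comm hj', mul_comm]
    rw [Finset.sum_congr rfl e1, Finset.sum_congr rfl e2]
    have e3 : ∑ j ∈ Finset.range (m + 1), (q ^ j * gaussCoeff q m j) • (a ^ j * b ^ (m + 1 - j))
        = ∑ j ∈ Finset.range (m + 1), (q ^ (j + 1) * gaussCoeff q m (j + 1)) •
            (a ^ (j + 1) * b ^ (m + 1 - (j + 1))) + b ^ (m + 1) := by
      rw [Finset.sum_range_succ' _ m, Finset.sum_range_succ _ m,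
        gaussCoeff_of_lt q m (m + 1) (by omega)]
      simp [gaussCoeff_zero_right]
    rw [e3, ← add_assoc, ← Finset.sum_add_distrib]
    simp [gaussCoeff, add_smul]

theorem add_pow_of_qcomm {q : k} {a b : R} {m : ℕ} (hq : IsPrimitiveRoot q m) (hm : 0 < m)
    (h : b * a = q • (a * b)) : (a + b) ^ m = a ^ m + b ^ m := by
  obtain ⟨m, rfl⟩ : ∃ l, m = l + 1 := ⟨m - 1, by omega⟩
  rw [qbinomial h, Finset.sum_range_succ, Finset.sum_range_succ', Finset.sum_eq_zero]
  · simp [gaussCoeff_self, gaussCoeff_zero_right, add_comm]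
  · intro j hj
    rw [gaussCoeff_eq_zero hq (by omega) (by simpa using hj), zero_smul]

/-- If `b a = q a b` with `q` a primitive `m`-th root of unity then `(-(a b)) ^ m = - a ^ m b ^ m`. -/
theorem neg_mul_pow_of_qcomm {q : k} {a b : R} {m : ℕ} (hq : IsPrimitiveRoot q m) (hm : 0 < m)
    (h : b * a = q • (a * b)) : (-(a * b)) ^ m = -(a ^ m * b ^ m) := by
  have key : ∀ l : ℕ, (-(a * b)) ^ l
      = ((-1) ^ l * q ^ (∑ i ∈ Finset.range l, i) : k) • (a ^ l * b ^ l) := by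
    intro l
    induction l with
    | zero => simp
    | succ l ih =>
      have hb : ∀ j : ℕ, b ^ j * a = q ^ j • (a * b ^ j) := by
        intro j
        induction j with
        | zero => simp
        | succ j ihj =>
          rw [pow_succ, mul_assoc, h, mul_smul_comm, ← mul_assoc, ihj, smul_mul_assoc, smul_smul,
            mul_assoc, pow_succ, mul_comm q]
      rw [pow_succ, ih, Finset.sum_range_succ, smul_mul_assoc, mul_neg, mul_assoc, ← mul_assoc (b ^ l),
        hb, smul_mul_assoc, mul_smul_comm, mul_assoc a, ← mul_assoc (a ^ l), ← pow_succ, ← pow_succ,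
        ← smul_neg, smul_smul, smul_neg, ← neg_smul]
      congr 1
      ring
  rw [key, ← neg_one_smul k (a ^ m * b ^ m)]
  congr 1
  rw [Finset.sum_range_id]
  rcases Nat.even_or_odd m with ⟨l, rfl⟩ | ⟨l, rfl⟩
  · have hl : 0 < l := by omega
    have h1 : q ^ l = -1 := by
      have h2 : q ^ l * q ^ l = 1 := by rw [← pow_add]; exact hq.pow_eq_one
      rcases mul_self_eq_one_iff.mp h2 with h3 | h3
      · exact absurd h3 (hq.pow_ne_one_of_pos_of_lt (by omega) (by omega))
      · exact h3
    have h2 : (l + l) * (l + l - 1) / 2 = l * (2 * (l - 1) + 1) := by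
      obtain ⟨l, rfl⟩ : ∃ r, l = r + 1 := ⟨l - 1, by omega⟩
      apply Nat.div_eq_of_eq_mul_left (by norm_num)
      rw [show l + 1 + (l + 1) - 1 = 2 * l + 1 by omega, show l + 1 - 1 = l by omega]
      ring
    rw [h2, pow_mul, h1, pow_succ, pow_mul, ← two_mul, pow_mul]
    simp
  · have h2 : (2 * l + 1) * (2 * l + 1 - 1) / 2 = (2 * l + 1) * l := by
      apply Nat.div_eq_of_eq_mul_left (by norm_num)
      rw [show 2 * l + 1 - 1 = 2 * l by omega]
      ring
    rw [h2, pow_mul, hq.pow_eq_one, one_pow, pow_succ, pow_mul]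
    simp

end

/-! ### The data and the algebra -/

/-- The data `(g, χ, λ)` of a lifting of a quantum linear space over `G`. The numbers `lam i` are the
`λ_i`, and `lamm i j` the `λ_{ij}`; the diagonal values `lamm i i` are never used. -/
structure Datum (k : Type u) [Field k] (G : Type v) [CommGroup G] (n : ℕ) where
  g : Fin n → G
  χ : Fin n → (G →* kˣ)
  lam : Fin n → k
  lamm : Fin n → Fin n → k
  χ_self_ne_one : ∀ i, χ i (g i) ≠ 1
  χ_mul_χ : ∀ i j, i ≠ j → χ i (g j) * χ j (g i) = 1
  lam_cond : ∀ i (a : G), lam i * ((χ i a : k) ^ orderOf (χ i (g i)) - 1) = 0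
  lamm_cond : ∀ i j, i ≠ j → ∀ a : G, lamm i j * ((χ i a : k) * (χ j a : k) - 1) = 0
  lamm_symm : ∀ i j, i ≠ j → lamm i j + (χ j (g i) : k) * lamm j i = 0

namespace Datum

variable {k : Type u} [Field k] {G : Type v} [CommGroup G] {n : ℕ} (D : Datum k G n)

/-- `q_{ij} = χ_j(g_i)`. -/
def q (i j : Fin n) : kˣ := D.χ j (D.g i)

/-- `m_i`, the order of `q_{ii}`. -/
def m (i : Fin n) : ℕ := orderOf (D.q i i)

/-- The generator of the free algebra attached to a group element. -/
abbrev gen (k : Type u) [Field k] {G : Type v} {n : ℕ} (a : G) : FreeAlgebra k (G ⊕ Fin n) :=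
  FreeAlgebra.ι k (Sum.inl a)

/-- The generator `x_i` of the free algebra. -/
abbrev genX (k : Type u) [Field k] (G : Type v) {n : ℕ} (i : Fin n) : FreeAlgebra k (G ⊕ Fin n) :=
  FreeAlgebra.ι k (Sum.inr i)

/-- The defining relations: those of the group `G`, and
`g x_i = χ_i(g) x_i g`, `x_i x_j = q_{ij} x_j x_i + λ_{ij} (1 - g_i g_j)` for `i ≠ j`,
`x_i ^ m_i = λ_i (1 - g_i ^ m_i)`. -/
inductive Rel : FreeAlgebra k (G ⊕ Fin n) → FreeAlgebra k (G ⊕ Fin n) → Prop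
  | one : Rel (gen k 1) 1
  | mul (a b : G) : Rel (gen k (a * b)) (gen k a * gen k b)
  | comm (a : G) (i : Fin n) : Rel (gen k a * genX k G i) ((D.χ i a : k) • (genX k G i * gen k a))
  | link (i j : Fin n) (h : i ≠ j) : Rel (genX k G i * genX k G j)
      ((D.q i j : k) • (genX k G j * genX k G i) + D.lamm i j • (1 - gen k (D.g i * D.g j)))
  | pow (i : Fin n) : Rel (genX k G i ^ D.m i) (D.lam i • (1 - gen k (D.g i ^ D.m i)))

/-- The lifting `H(g, χ, λ)` as an algebra. -/
def H : Type (max u v) := RingQuot D.Rel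

instance : Ring D.H := inferInstanceAs (Ring (RingQuot D.Rel))
instance : Algebra k D.H := inferInstanceAs (Algebra k (RingQuot D.Rel))

/-- The quotient map from the free algebra. -/
def quot : FreeAlgebra k (G ⊕ Fin n) →ₐ[k] D.H := RingQuot.mkAlgHom k D.Rel

theorem quot_surjective : Function.Surjective D.quot := RingQuot.mkAlgHom_surjective k D.Rel

theorem quot_rel {a b : FreeAlgebra k (G ⊕ Fin n)} (h : D.Rel a b) : D.quot a = D.quot b :=
  RingQuot.mkAlgHom_rel k h

/-- The group elements in `H`. -/
def of : G →* D.H where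
  toFun a := D.quot (gen k a)
  map_one' := by rw [D.quot_rel .one, map_one]
  map_mul' a b := by rw [D.quot_rel (.mul a b), map_mul]

/-- The generators `x_i` of `H`. -/
def x (i : Fin n) : D.H := D.quot (genX k G i)

theorem of_mul_x (a : G) (i : Fin n) : D.of a * D.x i = (D.χ i a : k) • (D.x i * D.of a) := by
  have := D.quot_rel (.comm a i)
  simp only [map_mul, map_smul] at this
  exact this

theorem x_mul_x (i j : Fin n) (h : i ≠ j) : D.x i * D.x j
    = (D.q i j : k) • (D.x j * D.x i) + D.lamm i j • (1 - D.of (D.g i * D.g j)) := by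
  have := D.quot_rel (.link i j h)
  simp only [map_mul, map_smul, map_add, map_sub, map_one] at this
  exact this

theorem x_pow (i : Fin n) : D.x i ^ D.m i = D.lam i • (1 - D.of (D.g i ^ D.m i)) := by
  have := D.quot_rel (.pow i)
  simp only [map_pow, map_smul, map_sub, map_one] at this
  exact this

theorem induction {P : D.H → Prop} (halg : ∀ c : k, P (algebraMap k D.H c))
    (hof : ∀ a, P (D.of a)) (hx : ∀ i, P (D.x i)) (hmul : ∀ a b, P a → P b → P (a * b))
    (hadd : ∀ a b, P a → P b → P (a + b)) (h : D.H) : P h := by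
  obtain ⟨y, rfl⟩ := D.quot_surjective h
  induction y using FreeAlgebra.induction with
  | grade0 r => rw [AlgHom.commutes]; exact halg r
  | grade1 z => rcases z with a | i; exacts [hof a, hx i]
  | mul a b ha hb => rw [map_mul]; exact hmul _ _ ha hb
  | add a b ha hb => rw [map_add]; exact hadd _ _ ha hb

theorem algHom_ext {B : Type w} [Semiring B] [Algebra k B] {e f : D.H →ₐ[k] B}
    (hof : ∀ a, e (D.of a) = f (D.of a)) (hx : ∀ i, e (D.x i) = f (D.x i)) : e = f := by
  ext h
  induction h using D.induction with
  | halg c => simp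
  | hof a => exact hof a
  | hx i => exact hx i
  | hmul a b ha hb => rw [map_mul, map_mul, ha, hb]
  | hadd a b ha hb => rw [map_add, map_add, ha, hb]

/-- The universal property of the presentation. -/
def lift {B : Type w} [Ring B] [Algebra k B] (e : G →* B) (y : Fin n → B)
    (h1 : ∀ a i, e a * y i = (D.χ i a : k) • (y i * e a))
    (h2 : ∀ i j, i ≠ j → y i * y j
      = (D.q i j : k) • (y j * y i) + D.lamm i j • (1 - e (D.g i * D.g j)))
    (h3 : ∀ i, y i ^ D.m i = D.lam i • (1 - e (D.g i ^ D.m i))) : D.H →ₐ[k] B :=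
  RingQuot.liftAlgHom k ⟨FreeAlgebra.lift k (Sum.elim e y), by
    intro a b h
    induction h with
    | one => simp [gen]
    | mul a b => simp [gen]
    | comm a i => simpa [gen, genX] using h1 a i
    | link i j h => simpa [gen, genX] using h2 i j h
    | pow i => simpa [gen, genX] using h3 i⟩

section
variable {B : Type w} [Ring B] [Algebra k B] (e : G →* B) (y : Fin n → B)
    (h1 : ∀ a i, e a * y i = (D.χ i a : k) • (y i * e a))
    (h2 : ∀ i j, i ≠ j → y i * y j
      = (D.q i j : k) • (y j * y i) + D.lamm i j • (1 - e (D.g i * D.g j)))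
    (h3 : ∀ i, y i ^ D.m i = D.lam i • (1 - e (D.g i ^ D.m i)))

@[simp] theorem lift_of (a : G) : D.lift e y h1 h2 h3 (D.of a) = e a := by
  change RingQuot.liftAlgHom k _ (RingQuot.mkAlgHom k D.Rel _) = _
  rw [RingQuot.liftAlgHom_mkAlgHom_apply]
  simp [gen]

@[simp] theorem lift_x (i : Fin n) : D.lift e y h1 h2 h3 (D.x i) = y i := by
  change RingQuot.liftAlgHom k _ (RingQuot.mkAlgHom k D.Rel _) = _
  rw [RingQuot.liftAlgHom_mkAlgHom_apply]
  simp [genX]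

end

/-! ### The Hopf algebra structure -/

theorem isPrimitiveRoot_q (i : Fin n) : IsPrimitiveRoot (D.q i i : k) (D.m i) :=
  IsPrimitiveRoot.coe_units_iff.mpr (IsPrimitiveRoot.orderOf _)

theorem q_mul_q (i j : Fin n) (h : i ≠ j) : (D.q i j : k) * (D.q j i : k) = 1 := by
  rw [← Units.val_mul, q, q, D.χ_mul_χ j i h.symm, Units.val_one]

theorem x_mul_of (a : G) (i : Fin n) : (D.χ i a : k) • (D.x i * D.of a) = D.of a * D.x i :=
  (D.of_mul_x a i).symm

theorem x_mul_of_inv (a : G) (i : Fin n) :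
    D.x i * D.of a⁻¹ = (D.χ i a : k) • (D.of a⁻¹ * D.x i) := by
  rw [D.of_mul_x, smul_smul, ← Units.val_mul, ← map_mul, mul_inv_cancel, map_one, Units.val_one, one_smul]

variable [Finite G]

theorem m_pos (i : Fin n) : 0 < D.m i := by
  rw [m, orderOf_pos_iff]
  exact MonoidHom.isOfFinOrder (D.χ i) (isOfFinOrder_of_finite (D.g i))

/-- The counit: `ε(g) = 1`, `ε(x_i) = 0`. -/
def counitHom : D.H →ₐ[k] k :=
  D.lift 1 0 (by simp) (by simp) (by intro i; simp [(D.m_pos i).ne'])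

/-- The comultiplication: `Δ(g) = g ⊗ g`, `Δ(x_i) = g_i ⊗ x_i + x_i ⊗ 1`. -/
def comulHom : D.H →ₐ[k] D.H ⊗[k] D.H :=
  D.lift
    { toFun := fun a => D.of a ⊗ₜ D.of a
      map_one' := by rw [map_one]; rfl
      map_mul' := fun a b => by rw [map_mul, Algebra.TensorProduct.tmul_mul_tmul] }
    (fun i => D.of (D.g i) ⊗ₜ D.x i + D.x i ⊗ₜ 1)
    (by
      intro a i
      simp only [MonoidHom.coe_mk, OneHom.coe_mk, mul_add, add_mul,
        Algebra.TensorProduct.tmul_mul_tmul, D.of_mul_x, mul_one, one_mul, smul_add,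
        TensorProduct.tmul_smul, TensorProduct.smul_tmul']
      rw [← map_mul, ← map_mul, mul_comm])
    (by
      intro i j h
      have e1 : D.of (D.g i) * D.x j = (D.q i j : k) • (D.x j * D.of (D.g i)) := D.of_mul_x _ _
      have e2 : D.of (D.g j) * D.x i = (D.q j i : k) • (D.x i * D.of (D.g j)) := D.of_mul_x _ _
      have e3 : D.of (D.g j) * D.of (D.g i) = D.of (D.g i * D.g j) := by
        rw [← map_mul, mul_comm]
      simp only [MonoidHom.coe_mk, OneHom.coe_mk, mul_add, add_mul,
        Algebra.TensorProduct.tmul_mul_tmul, mul_one, one_mul]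
      rw [e1, e2, e3, D.x_mul_x i j h, ← map_mul]
      simp only [TensorProduct.tmul_add, TensorProduct.add_tmul, TensorProduct.tmul_smul,
        ← TensorProduct.smul_tmul', TensorProduct.tmul_sub, TensorProduct.sub_tmul, smul_add,
        smul_sub, smul_smul, D.q_mul_q i j h, one_smul, Algebra.TensorProduct.one_def]
      abel)
    (by
      intro i
      have hq : (D.of (D.g i) ⊗ₜ[k] D.x i) * (D.x i ⊗ₜ[k] 1)
          = (D.q i i : k) • ((D.x i ⊗ₜ[k] 1) * (D.of (D.g i) ⊗ₜ[k] D.x i)) := by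
        simp only [Algebra.TensorProduct.tmul_mul_tmul, mul_one, one_mul, D.of_mul_x,
          ← TensorProduct.smul_tmul', q]
      rw [add_comm, add_pow_of_qcomm (D.isPrimitiveRoot_q i) (D.m_pos i) hq]
      simp only [MonoidHom.coe_mk, OneHom.coe_mk, Algebra.TensorProduct.tmul_pow, one_pow, D.x_pow,
        ← map_pow, TensorProduct.tmul_smul, ← TensorProduct.smul_tmul', TensorProduct.tmul_sub,
        TensorProduct.sub_tmul, smul_sub, Algebra.TensorProduct.one_def]
      abel)

/-- The antipode, as an algebra map to the opposite algebra: `S(g) = g⁻¹`, `S(x_i) = - g_i⁻¹ x_i`. -/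
def antipodeHom : D.H →ₐ[k] D.Hᵐᵒᵖ :=
  D.lift
    { toFun := fun a => MulOpposite.op (D.of a⁻¹)
      map_one' := by simp
      map_mul' := fun a b => by rw [← MulOpposite.op_mul, ← map_mul, mul_inv, mul_comm] }
    (fun i => MulOpposite.op (-(D.of (D.g i)⁻¹ * D.x i)))
    (by
      intro a i
      simp only [MonoidHom.coe_mk, OneHom.coe_mk, ← MulOpposite.op_mul, ← MulOpposite.op_smul]
      congr 1
      rw [neg_mul, mul_neg, mul_assoc, D.x_mul_of_inv, mul_smul_comm, ← mul_assoc, ← mul_assoc,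
        ← map_mul, ← map_mul, mul_comm a⁻¹, smul_neg])
    (by
      intro i j h
      simp only [MonoidHom.coe_mk, OneHom.coe_mk, ← MulOpposite.op_mul, ← MulOpposite.op_smul,
        ← MulOpposite.op_one, ← MulOpposite.op_sub, ← MulOpposite.op_add]
      congr 1
      have key : ∀ i j, -(D.of (D.g j)⁻¹ * D.x j) * -(D.of (D.g i)⁻¹ * D.x i)
          = (D.q i j : k) • (D.of (D.g i * D.g j)⁻¹ * (D.x j * D.x i)) := by
        intro i j
        rw [neg_mul_neg, mul_assoc, ← mul_assoc (D.x j), D.x_mul_of_inv, smul_mul_assoc,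
          mul_smul_comm, ← mul_assoc, ← mul_assoc, ← map_mul, ← mul_inv, mul_comm (D.g j), mul_assoc]
        rfl
      rw [key i j, key j i, smul_smul, D.q_mul_q i j h, one_smul, D.x_mul_x i j h,
        mul_comm (D.g j), mul_add, mul_smul_comm, mul_smul_comm, mul_sub, mul_one, ← map_mul,
        inv_mul_cancel, map_one, smul_sub, smul_sub]
      abel)
    (by
      intro i
      simp only [MonoidHom.coe_mk, OneHom.coe_mk, ← MulOpposite.op_pow, ← MulOpposite.op_smul,
        ← MulOpposite.op_one, ← MulOpposite.op_sub]
      congr 1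
      rw [neg_mul_pow_of_qcomm (D.isPrimitiveRoot_q i) (D.m_pos i) (D.x_mul_of_inv _ _), D.x_pow,
        ← map_pow, mul_smul_comm, mul_sub, mul_one, ← map_mul, inv_pow, inv_mul_cancel, map_one,
        ← smul_neg, neg_sub])

@[simp] theorem counitHom_of (a : G) : D.counitHom (D.of a) = 1 := by simp [counitHom]
@[simp] theorem counitHom_x (i : Fin n) : D.counitHom (D.x i) = 0 := by simp [counitHom]
@[simp] theorem comulHom_of (a : G) : D.comulHom (D.of a) = D.of a ⊗ₜ D.of a := by
  simp [comulHom]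
@[simp] theorem comulHom_x (i : Fin n) :
    D.comulHom (D.x i) = D.of (D.g i) ⊗ₜ D.x i + D.x i ⊗ₜ 1 := by
  simp [comulHom]

/-- The antipode as a linear map. -/
def antipodeLin : D.H →ₗ[k] D.H :=
  (MulOpposite.opLinearEquiv k).symm.toLinearMap ∘ₗ D.antipodeHom.toLinearMap

@[simp] theorem antipodeLin_of (a : G) : D.antipodeLin (D.of a) = D.of a⁻¹ := by
  simp [antipodeLin, antipodeHom]
@[simp] theorem antipodeLin_x (i : Fin n) :
    D.antipodeLin (D.x i) = -(D.of (D.g i)⁻¹ * D.x i) := by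
  simp [antipodeLin, antipodeHom]
@[simp] theorem antipodeLin_one : D.antipodeLin 1 = 1 := by
  simp [antipodeLin]
theorem antipodeLin_mul (a b : D.H) :
    D.antipodeLin (a * b) = D.antipodeLin b * D.antipodeLin a := by
  simp [antipodeLin]

instance : Bialgebra k D.H :=
  Bialgebra.ofAlgHom D.comulHom D.counitHom
    (by
      apply D.algHom_ext
      · intro a; simp
      · intro i
        simp [TensorProduct.tmul_add, TensorProduct.add_tmul, Algebra.TensorProduct.one_def,
          add_assoc])
    (by apply D.algHom_ext <;> simp)
    (by apply D.algHom_ext <;> simp)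

theorem comul_eq (h : D.H) : Coalgebra.comul (R := k) h = D.comulHom h := rfl
theorem counit_eq (h : D.H) : Coalgebra.counit (R := k) h = D.counitHom h := rfl

theorem antipode_left (h : D.H) :
    LinearMap.mul' k D.H (D.antipodeLin.rTensor D.H (D.comulHom h))
      = algebraMap k D.H (D.counitHom h) := by
  induction h using D.induction with
  | halg c => simp [Algebra.TensorProduct.one_def, Algebra.algebraMap_eq_smul_one]
  | hof a => simp [← map_mul]
  | hx i => simp
  | hadd a b ha hb => simp only [map_add, ha, hb]
  | hmul a b ha hb =>
    have key : ∀ (u : D.H ⊗[k] D.H) (c d : D.H),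
        LinearMap.mul' k D.H (D.antipodeLin.rTensor D.H (u * c ⊗ₜ d))
          = D.antipodeLin c * LinearMap.mul' k D.H (D.antipodeLin.rTensor D.H u) * d := by
      intro u c d
      induction u with
      | zero => simp
      | tmul e f => simp [antipodeLin_mul, mul_assoc]
      | add u v hu hv => simp only [add_mul, mul_add, map_add, hu, hv]
    have key2 : ∀ v : D.H ⊗[k] D.H,
        LinearMap.mul' k D.H (D.antipodeLin.rTensor D.H (D.comulHom a * v))
          = D.counitHom a • LinearMap.mul' k D.H (D.antipodeLin.rTensor D.H v) := by
      intro v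
      induction v with
      | zero => simp
      | tmul e f => rw [key, ha]; simp [Algebra.algebraMap_eq_smul_one]
      | add u v hu hv => simp only [mul_add, map_add, hu, hv, smul_add]
    rw [map_mul, key2, hb, map_mul, map_mul, Algebra.smul_def]

theorem antipode_right (h : D.H) :
    LinearMap.mul' k D.H (D.antipodeLin.lTensor D.H (D.comulHom h))
      = algebraMap k D.H (D.counitHom h) := by
  induction h using D.induction with
  | halg c => simp [Algebra.TensorProduct.one_def, Algebra.algebraMap_eq_smul_one]
  | hof a => simp [← map_mul]
  | hx i => simp [← mul_assoc, ← map_mul]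
  | hadd a b ha hb => simp only [map_add, ha, hb]
  | hmul a b ha hb =>
    have key : ∀ (u : D.H ⊗[k] D.H) (c d : D.H),
        LinearMap.mul' k D.H (D.antipodeLin.lTensor D.H (c ⊗ₜ d * u))
          = c * LinearMap.mul' k D.H (D.antipodeLin.lTensor D.H u) * D.antipodeLin d := by
      intro u c d
      induction u with
      | zero => simp
      | tmul e f => simp [antipodeLin_mul, mul_assoc]
      | add u v hu hv => simp only [add_mul, mul_add, map_add, hu, hv]
    have key2 : ∀ v : D.H ⊗[k] D.H,
        LinearMap.mul' k D.H (D.antipodeLin.lTensor D.H (v * D.comulHom b))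
          = D.counitHom b • LinearMap.mul' k D.H (D.antipodeLin.lTensor D.H v) := by
      intro v
      induction v with
      | zero => simp
      | tmul e f => rw [key, hb]; simp [Algebra.algebraMap_eq_smul_one]
      | add u v hu hv => simp only [add_mul, map_add, hu, hv, smul_add]
    rw [map_mul, key2, ha, map_mul, mul_comm, map_mul, Algebra.smul_def]

instance : HopfAlgebra k D.H where
  antipode := D.antipodeLin
  mul_antipode_rTensor_comul := LinearMap.ext D.antipode_left
  mul_antipode_lTensor_comul := LinearMap.ext D.antipode_right

end Datum

/-! ### Integrals, the Nakayama automorphism and the modular element -/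

section Integrals
variable (k : Type u) [Field k] (A : Type v) [Ring A] [HopfAlgebra k A]

/-- `t` is a right integral in the Hopf algebra `A`: `t a = ε(a) t` for all `a`. -/
def IsRightIntegral (t : A) : Prop :=
  ∀ a : A, t * a = Coalgebra.counit (R := k) a • t

/-- `φ` is a right integral in the dual of `A`: for the convolution product,
`φ * f = f(1) φ` for all `f`, where `(φ * f)(h) = φ(h₁) f(h₂)`. -/
def IsDualRightIntegral (φ : Module.Dual k A) : Prop :=
  ∀ (f : Module.Dual k A) (h : A),
    LinearMap.mul' k k (TensorProduct.map φ f (Coalgebra.comul (R := k) h)) = f 1 * φ h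

/-- A choice of: a nonzero right integral `φ` in the dual of `A`, an algebra automorphism `ρ` which is
the Nakayama automorphism with respect to `φ`, i.e. `a φ = φ ρ(a)` in the bimodule `A^*`
(where `(a φ)(b) = φ(b a)` and `(φ a)(b) = φ(a b)`); a nonzero right integral `t` in `A`, and the modular
element `α`, an algebra map with `a t = α(a) t`. -/
structure NakayamaData where
  φ : Module.Dual k A
  φ_ne_zero : φ ≠ 0
  φ_integral : IsDualRightIntegral k A φ
  ρ : A ≃ₐ[k] A
  φ_mul : ∀ a b : A, φ (b * a) = φ (ρ a * b)
  t : A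
  t_ne_zero : t ≠ 0
  t_integral : IsRightIntegral k A t
  α : A →ₐ[k] k
  mul_t : ∀ a : A, a * t = α a • t

end Integrals

/-! ### Strongly graded algebras and crossed products -/

section Graded
variable (k : Type u) [Field k] {A : Type v} [Ring A] [Algebra k A] {L : Type w} [Group L]

open scoped Classical in
/-- `A` is the direct sum of the subspaces `A_l`, `l ∈ L`. -/
def IsDecomposition {L : Type w} (𝒜 : L → Submodule k A) : Prop :=
  DirectSum.IsInternal 𝒜

/-- `A` is the direct sum of the subspaces `A_l`, `l ∈ L`, and `A_l A_l' = A_{l l'}`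
(the product of subspaces is the span of the products). -/
def IsStronglyGraded (𝒜 : L → Submodule k A) : Prop :=
  IsDecomposition k 𝒜 ∧ ∀ l l' : L, 𝒜 l * 𝒜 l' = 𝒜 (l * l')

/-- The data of a crossed product of an algebra `B` with the group algebra of `L`: a weak action of `L`
on `B` and a normal invertible cocycle `σ` satisfying the twisted module condition. -/
structure CrossedSystem (B : Type v) [Ring B] [Algebra k B] (L : Type w) [Group L] where
  act : L → (B →ₐ[k] B)
  σ : L → L → Bˣ
  act_one : ∀ b, act 1 b = b
  σ_one_left : ∀ l, σ 1 l = 1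
  σ_one_right : ∀ l, σ l 1 = 1
  twisted : ∀ l l' b, act l (act l' b) * (σ l l' : B) = (σ l l' : B) * act (l * l') b
  cocycle : ∀ l l' l'', act l (σ l' l'' : B) * (σ l (l' * l'') : B)
    = (σ l l' : B) * (σ (l * l') l'' : B)

/-- The graded algebra `A = ⊕ A_l` is a crossed product of its subalgebra `B` with `k L`: it is
isomorphic to `B ⊗ k L` with the product `(b ⊗ l) (b' ⊗ l') = b (l · b') σ(l, l') ⊗ l l'`, by an isomorphism
that is the inclusion on `B` and that maps `B ⊗ l` into `A_l`. -/
def IsCrossedProduct (B : Subalgebra k A) (𝒜 : L → Submodule k A) : Prop :=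
  ∃ (C : CrossedSystem k B L) (Φ : B ⊗[k] MonoidAlgebra k L ≃ₗ[k] A),
    (∀ (b b' : B) (l l' : L),
      Φ (b ⊗ₜ MonoidAlgebra.of k L l) * Φ (b' ⊗ₜ MonoidAlgebra.of k L l')
        = Φ ((b * C.act l b' * (C.σ l l' : B)) ⊗ₜ MonoidAlgebra.of k L (l * l'))) ∧
    (∀ b : B, Φ (b ⊗ₜ 1) = b) ∧
    (∀ (b : B) (l : L), Φ (b ⊗ₜ MonoidAlgebra.of k L l) ∈ 𝒜 l)

end Graded

/-! ### The decomposition of a lifting -/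

namespace Datum

variable {k : Type u} [Field k] {G : Type v} [CommGroup G] [Finite G] {n : ℕ} (D : Datum k G n)
  (N : NakayamaData k D.H)

/-- The character of `G` obtained by restricting the modular element `α`. -/
def αG : G →* kˣ := (N.α : D.H →* k).comp D.of |>.toHomUnits

/-- `L₂ = α(G)`. -/
def L₂ : Subgroup kˣ := (D.αG N).range

/-- `L₁ = ⟨q_{11}, …, q_{nn}, α(G)⟩`. -/
def L₁ : Subgroup kˣ :=
  Subgroup.closure (Set.range (fun i => D.q i i) ∪ Set.range (D.αG N))

/-- `H_ω = {h : ρ(h) = ω h}`, for `ω ∈ L₁`. -/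
def component (ω : D.L₁ N) : Submodule k D.H :=
  Module.End.eigenspace N.ρ.toLinearMap ((ω : kˣ) : k)

/-- The component `H_1`, as a subalgebra: the elements fixed by `ρ`. -/
def componentOne : Subalgebra k D.H :=
  AlgHom.equalizer (N.ρ : D.H →ₐ[k] D.H) (AlgHom.id k D.H)

end Datum

end QLS

end

/-!
The trace formula `f(t) = Tr(v ↦ a S²(v₁) f(v₂))` of Larson and Sweedler gives a nonzero right
integral `t` in any finite-dimensional Hopf algebra. The map `f ↦ f(t₁) t₂` is injective, hence
bijective, and the preimage of `1` is the integral `φ`. The form `(a, b) ↦ φ(ab)` is nondegenerate,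
whence `ρ` and `α`. Comparing `Δ(a) Δ(t) = α(a) Δ(t)` with the defining property of `ρ` shows
`ρ(a) = α(a)⁻¹ a` on group elements and `ρ(xᵢ) = (qᵢᵢ α(gᵢ))⁻¹ xᵢ`, so `ρ` is diagonalizable with
eigenvalues in `L₁`.

If the grading is strong, then the counit vanishes on no component. As `ε ∘ ρ^d = ε` for `d = |L₂|`,
every `ω ∈ L₁` satisfies `ω^d = 1`, and a field has at most `d` such elements, so `ω ∈ L₂`.
Conversely, if `L₁ = L₂`, every component contains a group element; being invertible, these give the
crossed product, and its units make the grading strong.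
-/

noncomputable section

namespace QLS

open Coalgebra HopfAlgebra

section Slices

variable {R M M' N : Type*} [CommSemiring R] [AddCommMonoid M] [Module R M] [AddCommMonoid M']
  [Module R M'] [AddCommMonoid N] [Module R N]

/-- The map `f ⊗ id : M ⊗ N → N`, linear in the functional `f` as well. -/
def sliceLeft : Module.Dual R M →ₗ[R] M ⊗[R] N →ₗ[R] N :=
  (LinearMap.rTensorHom N).compr₂ (TensorProduct.lid R N).toLinearMap

/-- The map `id ⊗ f : M ⊗ N → M`, linear in the functional `f` as well. -/
def sliceRight : Module.Dual R N →ₗ[R] M ⊗[R] N →ₗ[R] M :=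
  (LinearMap.lTensorHom M).compr₂ (TensorProduct.rid R M).toLinearMap

@[simp]
theorem sliceLeft_tmul (f : Module.Dual R M) (m : M) (n : N) :
    sliceLeft f (m ⊗ₜ n) = f m • n := rfl

@[simp]
theorem sliceRight_tmul (f : Module.Dual R N) (m : M) (n : N) :
    sliceRight f (m ⊗ₜ n) = f n • m := rfl

theorem sliceLeft_rTensor (f : Module.Dual R M') (e : M →ₗ[R] M') (w : M ⊗[R] N) :
    sliceLeft f (e.rTensor N w) = sliceLeft (f ∘ₗ e) w := by
  induction w with
  | zero => simp only [map_zero]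
  | tmul m n => rfl
  | add w w' hw hw' => simp only [map_add, hw, hw']

theorem sliceRight_rTensor (f : Module.Dual R N) (e : M →ₗ[R] M') (w : M ⊗[R] N) :
    sliceRight f (e.rTensor N w) = e (sliceRight f w) := by
  induction w with
  | zero => simp only [map_zero]
  | tmul m n => simp
  | add w w' hw hw' => simp only [map_add, hw, hw']

theorem mul'_map_eq_apply_sliceLeft (φ : Module.Dual R M) (f : Module.Dual R N) (w : M ⊗[R] N) :
    LinearMap.mul' R R (TensorProduct.map φ f w) = f (sliceLeft φ w) := by
  induction w with
  | zero => simp only [map_zero]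
  | tmul m n => simp
  | add w w' hw hw' => simp only [map_add, hw, hw']

end Slices

section SlicesMul

variable {R A B : Type*} [CommSemiring R] [Semiring A] [Algebra R A] [Semiring B] [Algebra R B]

theorem sliceLeft_mul_one_tmul (f : Module.Dual R A) (w : A ⊗[R] B) (b : B) :
    sliceLeft f (w * 1 ⊗ₜ b) = sliceLeft f w * b := by
  induction w with
  | zero => simp only [zero_mul, map_zero]
  | tmul m n => simp
  | add w w' hw hw' => simp only [add_mul, map_add, hw, hw']

theorem sliceLeft_one_tmul_mul (f : Module.Dual R A) (w : A ⊗[R] B) (b : B) :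
    sliceLeft f (1 ⊗ₜ b * w) = b * sliceLeft f w := by
  induction w with
  | zero => simp only [mul_zero, map_zero]
  | tmul m n => simp
  | add w w' hw hw' => simp only [mul_add, map_add, hw, hw']

theorem sliceLeft_mul_tmul_one (f : Module.Dual R A) (w : A ⊗[R] B) (a : A) :
    sliceLeft f (w * a ⊗ₜ 1) = sliceLeft (f ∘ₗ LinearMap.mulRight R a) w := by
  induction w with
  | zero => simp only [zero_mul, map_zero]
  | tmul m n => simp
  | add w w' hw hw' => simp only [add_mul, map_add, hw, hw']

theorem sliceLeft_tmul_one_mul (f : Module.Dual R A) (w : A ⊗[R] B) (a : A) :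
    sliceLeft f (a ⊗ₜ 1 * w) = sliceLeft (f ∘ₗ LinearMap.mulLeft R a) w := by
  induction w with
  | zero => simp only [mul_zero, map_zero]
  | tmul m n => simp
  | add w w' hw hw' => simp only [mul_add, map_add, hw, hw']

theorem sliceRight_mul_one_tmul (f : Module.Dual R B) (w : A ⊗[R] B) (b : B) :
    sliceRight f (w * 1 ⊗ₜ b) = sliceRight (f ∘ₗ LinearMap.mulRight R b) w := by
  induction w with
  | zero => simp only [zero_mul, map_zero]
  | tmul m n => simp
  | add w w' hw hw' => simp only [add_mul, map_add, hw, hw']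

theorem sliceRight_mul_tmul_one (f : Module.Dual R B) (w : A ⊗[R] B) (a : A) :
    sliceRight f (w * a ⊗ₜ 1) = sliceRight f w * a := by
  induction w with
  | zero => simp only [zero_mul, map_zero]
  | tmul m n => simp
  | add w w' hw hw' => simp only [add_mul, map_add, hw, hw']

end SlicesMul

section Hits

variable {R C : Type*} [CommSemiring R] [AddCommMonoid C] [Module R C] [Coalgebra R C]

/-- The right action `h ↼ f = f(h₁) h₂` of the dual of a coalgebra. -/
def rightHit (f : Module.Dual R C) : C →ₗ[R] C := sliceLeft f ∘ₗ comul

/-- The left action `f ⇀ h = h₁ f(h₂)` of the dual of a coalgebra, linear in `f` as well. -/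
def leftHit : Module.Dual R C →ₗ[R] Module.End R C := sliceRight.compl₂ comul

theorem rightHit_apply (f : Module.Dual R C) (h : C) : rightHit f h = sliceLeft f (comul h) := rfl

theorem leftHit_apply (f : Module.Dual R C) (h : C) :
    leftHit f h = sliceRight f (comul h) := rfl

theorem comul_rightHit (f : Module.Dual R C) (h : C) :
    comul (R := R) (rightHit f h) = (rightHit f).rTensor C (comul h) := by
  have slice_assoc (w : (C ⊗[R] C) ⊗[R] C) : (sliceLeft f).rTensor C w
      = sliceLeft f (TensorProduct.assoc R C C C w) := by
    induction w with
    | zero => simp only [map_zero]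
    | add w w' hw hw' => simp only [map_add, hw, hw']
    | tmul w c =>
      induction w with
      | zero => simp only [TensorProduct.zero_tmul, map_zero]
      | add w w' hw hw' => simp only [TensorProduct.add_tmul, map_add, hw, hw']
      | tmul a b => simp [TensorProduct.smul_tmul']
  have slice_comul (w : C ⊗[R] C) : sliceLeft f (comul.lTensor C w)
      = comul (R := R) (sliceLeft f w) := by
    induction w with
    | zero => simp only [map_zero]
    | add w w' hw hw' => simp only [map_add, hw, hw']
    | tmul a b => simp
  rw [rightHit, LinearMap.rTensor_comp_apply, slice_assoc, coassoc_apply, slice_comul,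
    LinearMap.comp_apply]

end Hits

section HopfIdentities

variable {R A ι : Type*} [CommSemiring R] [Semiring A] [HopfAlgebra R A] {b : A}

theorem sum_comul_mul_one_tmul_antipode (r : Repr R b ι) :
    ∑ i ∈ r.index, comul (R := R) (r.left i) * 1 ⊗ₜ antipode R (r.right i) = b ⊗ₜ[R] 1 := by
  let Θ := (LinearMap.mul' R A ∘ₗ (antipode R).lTensor A).lTensor A
  calc ∑ i ∈ r.index, comul (R := R) (r.left i) * 1 ⊗ₜ antipode R (r.right i)
      = Θ (∑ i ∈ r.index, ∑ j ∈ (ℛ R (r.left i)).index, (ℛ R (r.left i)).left j ⊗ₜ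
          ((ℛ R (r.left i)).right j ⊗ₜ r.right i)) := by
        simp [Θ, ← (ℛ R (r.left _)).eq, Finset.sum_mul]
    _ = Θ (∑ i ∈ r.index, r.left i ⊗ₜ comul (r.right i)) := by
        rw [sum_tmul_tmul_eq r _ fun i => ℛ R (r.right i)]
        simp_rw [← TensorProduct.tmul_sum, Repr.eq]
    _ = ∑ i ∈ r.index, r.left i ⊗ₜ algebraMap R A (counit (R := R) (r.right i)) := by
        simp [Θ]
    _ = b ⊗ₜ 1 := by
        simpa only [map_sum, LinearMap.lTensor_tmul, Algebra.linearMap_apply, map_one]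
          using congr((Algebra.linearMap R A).lTensor A $(sum_tmul_counit_eq r))

theorem sum_tmul_one_mul_rTensor_antipode_comul (r : Repr R b ι) :
    ∑ i ∈ r.index, r.left i ⊗ₜ[R] 1 * (antipode R).rTensor A (comul (r.right i)) = 1 ⊗ₜ b := by
  let Θ := (LinearMap.mul' R A ∘ₗ (antipode R).lTensor A).rTensor A ∘ₗ
    (TensorProduct.assoc R A A A).symm.toLinearMap
  calc ∑ i ∈ r.index, r.left i ⊗ₜ[R] 1 * (antipode R).rTensor A (comul (r.right i))
      = Θ (∑ i ∈ r.index, ∑ j ∈ (ℛ R (r.right i)).index, r.left i ⊗ₜ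
          ((ℛ R (r.right i)).left j ⊗ₜ (ℛ R (r.right i)).right j)) := by
        simp [Θ, ← (ℛ R (r.right _)).eq, Finset.mul_sum]
    _ = Θ (TensorProduct.assoc R A A A (∑ i ∈ r.index, comul (r.left i) ⊗ₜ r.right i)) := by
        rw [← sum_tmul_tmul_eq r fun i => ℛ R (r.left i)]
        simp [← (ℛ R (r.left _)).eq, TensorProduct.sum_tmul]
    _ = ∑ i ∈ r.index, algebraMap R A (counit (R := R) (r.left i)) ⊗ₜ r.right i := by
        simp [Θ]
    _ = 1 ⊗ₜ b := by
        simpa only [map_sum, LinearMap.rTensor_tmul, Algebra.linearMap_apply, map_one]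
          using congr((Algebra.linearMap R A).rTensor A $(sum_counit_tmul_eq r))

variable (R A) in
/-- The square of the antipode, which is an algebra endomorphism because the antipode reverses
products. -/
def antipodeSq : A →ₐ[R] A :=
  .ofLinearMap (antipode R ∘ₗ antipode R) (by simp) (by simp [antipode_mul_antidistrib])

theorem toLinearMap_antipodeSq :
    (antipodeSq R A).toLinearMap = antipode R ∘ₗ antipode R := rfl

theorem sum_rTensor_antipodeSq_comul_mul (r : Repr R b ι) :
    ∑ i ∈ r.index, (antipodeSq R A).toLinearMap.rTensor A (comul (r.right i)) *
      antipode R (r.left i) ⊗ₜ[R] 1 = 1 ⊗ₜ b := by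
  have antipode_mul_tmul_one (a : A) (w : A ⊗[R] A) : (antipode R).rTensor A (a ⊗ₜ 1 * w)
      = (antipode R).rTensor A w * antipode R a ⊗ₜ 1 := by
    induction w with
    | zero => simp only [mul_zero, map_zero, zero_mul]
    | tmul c d => simp [antipode_mul_antidistrib]
    | add w w' hw hw' => simp only [mul_add, map_add, add_mul, hw, hw']
  have h := congr((antipode R).rTensor A $(sum_tmul_one_mul_rTensor_antipode_comul r))
  simpa only [map_sum, antipode_mul_tmul_one, ← LinearMap.rTensor_comp_apply,
    LinearMap.rTensor_tmul, antipode_one, ← toLinearMap_antipodeSq] using h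

end HopfIdentities

section TraceIntegral

variable {k A ι : Type*} [Field k] [Ring A] [HopfAlgebra k A]

theorem sum_mulRight_antipode_comp_antipodeSq_comp_leftHit_comp_mulRight
    (f : Module.Dual k A) {b : A} (r : Repr k b ι) :
    ∑ i ∈ r.index, LinearMap.mulRight k (antipode k (r.left i)) ∘ₗ
        ((antipodeSq k A).toLinearMap ∘ₗ leftHit f) ∘ₗ LinearMap.mulRight k (r.right i)
      = (antipodeSq k A).toLinearMap ∘ₗ leftHit (f ∘ₗ LinearMap.mulRight k b) := by
  let Θ : A ⊗[k] A →ₐ[k] A ⊗[k] A := Algebra.TensorProduct.map (antipodeSq k A) (AlgHom.id k A)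
  have antipodeSq_leftHit (g : Module.Dual k A) (a : A) :
      antipodeSq k A (leftHit g a) = sliceRight g (Θ (comul a)) :=
    (sliceRight_rTensor g (antipodeSq k A).toLinearMap (comul a)).symm
  ext v
  calc (∑ i ∈ r.index, LinearMap.mulRight k (antipode k (r.left i)) ∘ₗ
          ((antipodeSq k A).toLinearMap ∘ₗ leftHit f) ∘ₗ LinearMap.mulRight k (r.right i)) v
      = sliceRight f (Θ (comul v) *
          ∑ i ∈ r.index, Θ (comul (r.right i)) * antipode k (r.left i) ⊗ₜ 1) := by
        simp [antipodeSq_leftHit, Finset.mul_sum, ← mul_assoc, sliceRight_mul_tmul_one]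
    _ = sliceRight f (Θ (comul v) * 1 ⊗ₜ b) :=
        congr(sliceRight f (Θ (comul v) * $(sum_rTensor_antipodeSq_comul_mul r)))
    _ = antipodeSq k A (leftHit (f ∘ₗ LinearMap.mulRight k b) v) := by
        rw [sliceRight_mul_one_tmul, antipodeSq_leftHit]

variable [FiniteDimensional k A]

/-- The element `t` of `A` such that `f(t) = Tr(v ↦ a S²(v₁) f(v₂))` for every functional `f`, an
integral by the trace formula of Larson and Sweedler. -/
def traceIntegral (a : A) : A :=
  (Module.evalEquiv k A).symm (LinearMap.trace k A ∘ₗ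
    LinearMap.mulLeft k (LinearMap.mulLeft k a ∘ₗ (antipodeSq k A).toLinearMap) ∘ₗ leftHit)

theorem apply_traceIntegral (f : Module.Dual k A) (a : A) : f (traceIntegral (k := k) a) =
    LinearMap.trace k A (LinearMap.mulLeft k a ∘ₗ (antipodeSq k A).toLinearMap ∘ₗ leftHit f) :=
  congr($((Module.evalEquiv k A).apply_symm_apply (LinearMap.trace k A ∘ₗ
    LinearMap.mulLeft k (LinearMap.mulLeft k a ∘ₗ (antipodeSq k A).toLinearMap) ∘ₗ leftHit)) f)

theorem isRightIntegral_traceIntegral (a : A) :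
    IsRightIntegral k A (traceIntegral (k := k) a) := by
  refine fun b => (Module.forall_dual_apply_eq_zero_iff k _).1 (fun f => ?_) |> sub_eq_zero.1
  let r := ℛ k b
  let X := LinearMap.mulLeft k a ∘ₗ (antipodeSq k A).toLinearMap ∘ₗ leftHit f
  have sum_antipode_mul : ∑ i ∈ r.index, (X ∘ₗ LinearMap.mulRight k (r.right i)) ∘ₗ
      LinearMap.mulRight k (antipode k (r.left i)) = counit (R := k) b • X := by
    ext v
    simp only [LinearMap.sum_apply, LinearMap.comp_apply, LinearMap.mulRight_apply, mul_assoc,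
      ← map_sum, ← Finset.mul_sum, sum_antipode_mul_eq_smul, mul_smul_comm, mul_one, map_smul,
      LinearMap.smul_apply]
  rw [map_sub, sub_eq_zero]
  calc f (traceIntegral (k := k) a * b)
      = LinearMap.trace k A (LinearMap.mulLeft k a ∘ₗ (antipodeSq k A).toLinearMap ∘ₗ
          leftHit (f ∘ₗ LinearMap.mulRight k b)) := apply_traceIntegral (f ∘ₗ .mulRight k b) a
    _ = ∑ i ∈ r.index, LinearMap.trace k A (LinearMap.mulRight k (antipode k (r.left i)) ∘ₗ
          X ∘ₗ LinearMap.mulRight k (r.right i)) := by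
        rw [← sum_mulRight_antipode_comp_antipodeSq_comp_leftHit_comp_mulRight f r, ← map_sum]
        congr 1
        ext v
        simp [X, mul_assoc]
    _ = LinearMap.trace k A (∑ i ∈ r.index, (X ∘ₗ LinearMap.mulRight k (r.right i)) ∘ₗ
          LinearMap.mulRight k (antipode k (r.left i))) := by
        rw [map_sum]
        exact Finset.sum_congr rfl fun i _ => LinearMap.trace_comp_comm' _ _
    _ = f (counit (R := k) b • traceIntegral (k := k) a) := by
        rw [sum_antipode_mul, map_smul, map_smul, ← apply_traceIntegral]

theorem exists_traceIntegral_ne_zero : ∃ a : A, traceIntegral (k := k) a ≠ 0 := by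
  by_contra! h
  let e := Module.finBasis k A
  have sum_eq : ∑ j, LinearMap.mulLeft k (antipode k (e j)) ∘ₗ (antipodeSq k A).toLinearMap ∘ₗ
      leftHit (e.coord j) = (counit : A →ₗ[k] k).smulRight 1 := by
    ext v
    let r := ℛ k v
    calc (∑ j, LinearMap.mulLeft k (antipode k (e j)) ∘ₗ (antipodeSq k A).toLinearMap ∘ₗ
          leftHit (e.coord j)) v
        = ∑ j, ∑ i ∈ r.index,
            antipode k (e.repr (r.right i) j • e j) * antipode k (antipode k (r.left i)) := by
          simp [leftHit_apply, ← r.eq, toLinearMap_antipodeSq]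
      _ = ∑ i ∈ r.index, antipode k (r.right i) * antipode k (antipode k (r.left i)) := by
          rw [Finset.sum_comm]
          simp_rw [← Finset.sum_mul, ← map_sum, e.sum_repr]
      _ = antipode k (∑ i ∈ r.index, antipode k (r.left i) * r.right i) := by
          simp_rw [map_sum, antipode_mul_antidistrib]
      _ = counit (R := k) v • 1 := by
          rw [sum_antipode_mul_eq_smul, map_smul, antipode_one]
  have trace_eq := congr(LinearMap.trace k A $sum_eq)
  simp_rw [map_sum, ← apply_traceIntegral, h, map_zero, Finset.sum_const_zero,
    LinearMap.trace_smulRight, Bialgebra.counit_one] at trace_eq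
  exact zero_ne_one trace_eq

theorem exists_isRightIntegral_ne_zero (k A : Type*) [Field k] [Ring A] [HopfAlgebra k A]
    [FiniteDimensional k A] : ∃ t : A, IsRightIntegral k A t ∧ t ≠ 0 :=
  let ⟨a, ha⟩ := exists_traceIntegral_ne_zero (k := k) (A := A)
  ⟨traceIntegral (k := k) a, isRightIntegral_traceIntegral a, ha⟩

end TraceIntegral

theorem exists_repr_left_of_sliceLeft_comul_eq_zero {k C ι : Type*} [Field k] [AddCommGroup C]
    [Module k C] [Coalgebra k C] (f : ι → Module.Dual k C) {a : C}
    (h : ∀ i, sliceLeft (f i) (comul a) = 0) :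
    ∃ r : Repr k a (Module.Basis.ofVectorSpaceIndex k C), ∀ i j, f i (r.left j) = 0 := by
  let e := Module.Basis.ofVectorSpace k C
  obtain ⟨c, hc⟩ := TensorProduct.eq_repr_basis_right e (comul (R := k) a)
  refine ⟨⟨c.support, c, e, hc⟩, fun i => ?_⟩
  have slice_eq : (c.mapRange (f i) (map_zero _)).sum (fun j s => s • e j) = 0 := by
    rw [Finsupp.sum_mapRange_index (by simp), ← h i, ← hc, Finsupp.sum, Finsupp.sum, map_sum]
    simp only [sliceLeft_tmul]
  exact DFunLike.congr_fun (linearIndependent_iff.1 e.linearIndependent _ slice_eq)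

section KerRightIdeal

variable {R A : Type*} [CommSemiring R] [Semiring A] [Algebra R A]

/-- The largest right ideal of `A` on which the functional `f` vanishes. It is zero exactly when
the bilinear form `(a, b) ↦ f (a b)` is nondegenerate on the left. -/
def kerRightIdeal (f : Module.Dual R A) : Submodule R A :=
  LinearMap.ker ((LinearMap.mul R A).compr₂ f)

theorem mem_kerRightIdeal {f : Module.Dual R A} {a : A} :
    a ∈ kerRightIdeal f ↔ ∀ b, f (a * b) = 0 := LinearMap.ext_iff

theorem mem_kerRightIdeal_iff_comp_mulLeft {f : Module.Dual R A} {a : A} :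
    a ∈ kerRightIdeal f ↔ f ∘ₗ LinearMap.mulLeft R a = 0 := Iff.rfl

theorem mul_mem_kerRightIdeal {f : Module.Dual R A} {a : A} (ha : a ∈ kerRightIdeal f) (b : A) :
    a * b ∈ kerRightIdeal f :=
  mem_kerRightIdeal.2 fun c => by rw [mul_assoc, mem_kerRightIdeal.1 ha]

end KerRightIdeal

section Integrals

variable {k A : Type*} [Field k] [Ring A] [HopfAlgebra k A]

theorem exists_repr_left_mem_kerRightIdeal {f : Module.Dual k A} {a : A}
    (h : ∀ b : A, sliceLeft f (comul a * b ⊗ₜ 1) = 0) :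
    ∃ r : Repr k a (Module.Basis.ofVectorSpaceIndex k A), ∀ j, r.left j ∈ kerRightIdeal f := by
  simp only [sliceLeft_mul_tmul_one] at h
  obtain ⟨r, hr⟩ := exists_repr_left_of_sliceLeft_comul_eq_zero _ h
  exact ⟨r, fun j => mem_kerRightIdeal.2 fun b => hr b j⟩

theorem IsRightIntegral.comul_mul_tmul_one {t : A} (ht : IsRightIntegral k A t) (b : A) :
    comul (R := k) t * b ⊗ₜ 1 = comul (R := k) t * 1 ⊗ₜ antipode k b := by
  rw [← sum_comul_mul_one_tmul_antipode (ℛ k b), Finset.mul_sum]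
  simp_rw [← mul_assoc, ← Bialgebra.comul_mul, ht _, map_smul, smul_mul_assoc, ← mul_smul_comm,
    ← Finset.mul_sum, ← TensorProduct.tmul_smul, ← TensorProduct.tmul_sum, ← map_smul, ← map_sum,
    sum_counit_smul]

theorem IsRightIntegral.sliceLeft_comul_injective {t : A} (ht : IsRightIntegral k A t)
    (ht₀ : t ≠ 0) : Function.Injective fun f : Module.Dual k A => sliceLeft f (comul t) := by
  refine (injective_iff_map_eq_zero (sliceLeft.flip (comul t) : Module.Dual k A →ₗ[k] A)).2
    fun f hf => ?_
  obtain ⟨r, hr⟩ := exists_repr_left_mem_kerRightIdeal (f := f) (a := t) fun b => by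
    rw [ht.comul_mul_tmul_one, sliceLeft_mul_one_tmul, ← LinearMap.flip_apply, hf, zero_mul]
  ext b
  have slice_eq : f b • t = 0 := by
    rw [← sliceLeft_tmul, ← one_mul b, ← mul_one t, ← Algebra.TensorProduct.tmul_mul_tmul,
      ← sum_tmul_one_mul_rTensor_antipode_comul r, Finset.sum_mul, map_sum]
    refine Finset.sum_eq_zero fun i _ => ?_
    rw [mul_assoc, sliceLeft_tmul_one_mul, mem_kerRightIdeal_iff_comp_mulLeft.1 (hr i), map_zero,
      LinearMap.zero_apply]
  exact (smul_eq_zero.1 slice_eq).resolve_right ht₀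

theorem isDualRightIntegral_iff {φ : Module.Dual k A} :
    IsDualRightIntegral k A φ ↔ ∀ h, rightHit φ h = φ h • 1 := by
  simp_rw [IsDualRightIntegral, mul'_map_eq_apply_sliceLeft, ← rightHit_apply]
  refine ⟨fun hφ h => sub_eq_zero.1 ((Module.forall_dual_apply_eq_zero_iff k _).1 fun f => ?_),
    fun hφ f h => by rw [hφ, map_smul, smul_eq_mul, mul_comm]⟩
  rw [map_sub, hφ, map_smul, smul_eq_mul, mul_comm, sub_self]

theorem IsRightIntegral.isDualRightIntegral_of_sliceLeft_eq_one {t : A}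
    (ht : IsRightIntegral k A t) (ht₀ : t ≠ 0) {φ : Module.Dual k A} (hφ : rightHit φ t = 1) :
    IsDualRightIntegral k A φ := by
  intro f h
  rw [mul'_map_eq_apply_sliceLeft]
  suffices f ∘ₗ rightHit φ = f 1 • φ from congr($this h)
  apply ht.sliceLeft_comul_injective ht₀
  calc sliceLeft (f ∘ₗ rightHit φ) (comul t) = rightHit f (rightHit φ t) := by
        rw [rightHit_apply, comul_rightHit, sliceLeft_rTensor]
    _ = f 1 • 1 := by
        simp [hφ, rightHit_apply, Algebra.TensorProduct.one_def]
    _ = sliceLeft (f 1 • φ) (comul t) := by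
        rw [map_smul, LinearMap.smul_apply, ← rightHit_apply, hφ]

theorem exists_isDualRightIntegral_ne_zero (k A : Type*) [Field k] [Ring A] [HopfAlgebra k A]
    [FiniteDimensional k A] : ∃ φ : Module.Dual k A, IsDualRightIntegral k A φ ∧ φ ≠ 0 := by
  obtain ⟨t, ht, ht₀⟩ := exists_isRightIntegral_ne_zero k A
  obtain ⟨φ, hφ : rightHit φ t = 1⟩ := (LinearMap.injective_iff_surjective_of_finrank_eq_finrank
    (f := (sliceLeft.flip (comul t) : Module.Dual k A →ₗ[k] A))
      Subspace.dual_finrank_eq).1 (ht.sliceLeft_comul_injective ht₀) 1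
  refine ⟨φ, ht.isDualRightIntegral_of_sliceLeft_eq_one ht₀ hφ, ?_⟩
  rintro rfl
  have : Nontrivial A := ⟨t, 0, ht₀⟩
  simp [rightHit_apply] at hφ

theorem IsDualRightIntegral.sliceLeft_comul_mul_tmul_one {φ : Module.Dual k A}
    (hφ : IsDualRightIntegral k A φ) (a b : A) : sliceLeft φ (comul a * b ⊗ₜ 1)
      = ∑ i ∈ (ℛ k b).index, φ (a * (ℛ k b).left i) • antipode k ((ℛ k b).right i) := by
  rw [← sum_comul_mul_one_tmul_antipode (ℛ k b), Finset.mul_sum, map_sum]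
  simp_rw [← mul_assoc, ← Bialgebra.comul_mul, sliceLeft_mul_one_tmul, ← rightHit_apply,
    isDualRightIntegral_iff.1 hφ, smul_mul_assoc, one_mul]

-- `Δ` maps the right ideal `J` into `J ⊗ A`. If `ε` did not vanish on `J`, the antipode axiom would
-- put `1` into `J`; and if it does, the counit axiom gives `J = 0`.
theorem IsDualRightIntegral.kerRightIdeal_eq_bot {φ : Module.Dual k A}
    (hφ : IsDualRightIntegral k A φ) (hφ₀ : φ ≠ 0) : kerRightIdeal φ = ⊥ := by
  have exists_repr {a : A} (ha : a ∈ kerRightIdeal φ) :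
      ∃ r : Repr k a (Module.Basis.ofVectorSpaceIndex k A), ∀ j, r.left j ∈ kerRightIdeal φ :=
    exists_repr_left_mem_kerRightIdeal fun b => by
      simp [hφ.sliceLeft_comul_mul_tmul_one, mem_kerRightIdeal.1 ha]
  have one_notMem : (1 : A) ∉ kerRightIdeal φ := fun h =>
    hφ₀ (LinearMap.ext fun b => by simpa using mem_kerRightIdeal.1 h b)
  have counit_eq_zero {a : A} (ha : a ∈ kerRightIdeal φ) : counit (R := k) a = 0 := by
    obtain ⟨r, hr⟩ := exists_repr ha
    by_contra h
    refine one_notMem ((Submodule.smul_mem_iff _ h).1 ?_)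
    rw [← sum_mul_antipode_eq_smul r]
    exact Submodule.sum_mem _ fun i _ => mul_mem_kerRightIdeal (hr i) _
  refine (Submodule.eq_bot_iff _).2 fun a ha => ?_
  obtain ⟨r, hr⟩ := exists_repr ha
  rw [← sum_counit_smul r]
  exact Finset.sum_eq_zero fun i _ => by rw [counit_eq_zero (hr i), zero_smul]

end Integrals

section Nakayama

variable {k A : Type*} [Field k]

theorem exists_nakayamaAutomorphism [Ring A] [Algebra k A] [FiniteDimensional k A]
    {φ : Module.Dual k A} (hφ : kerRightIdeal φ = ⊥) :
    ∃ ρ : A ≃ₐ[k] A, ∀ a b, φ (b * a) = φ (ρ a * b) := by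
  let e : A ≃ₗ[k] Module.Dual k A := LinearEquiv.ofInjectiveOfFinrankEq
    ((LinearMap.mul k A).compr₂ φ) (LinearMap.ker_eq_bot.1 hφ) Subspace.dual_finrank_eq.symm
  have eq_of_forall {a b : A} (h : ∀ c, φ (a * c) = φ (b * c)) : a = b :=
    e.injective (LinearMap.ext h)
  let ρ : A →ₗ[k] A := e.symm.toLinearMap ∘ₗ ((LinearMap.mul k A).flip.compr₂ φ)
  have φ_mul (a b : A) : φ (b * a) = φ (ρ a * b) :=
    congr($(e.apply_symm_apply ((LinearMap.mul k A).flip.compr₂ φ a)) b).symm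
  have ρ_injective : Function.Injective ρ := by
    refine (injective_iff_map_eq_zero ρ).2 fun a ha => ?_
    refine (Module.forall_dual_apply_eq_zero_iff k a).1 fun f => ?_
    rw [← e.apply_symm_apply f]
    change φ (e.symm f * a) = 0
    rw [φ_mul, ha, zero_mul, map_zero]
  have ρ_one : ρ 1 = 1 := eq_of_forall fun c => by rw [← φ_mul, mul_one, one_mul]
  have ρ_mul (a b : A) : ρ (a * b) = ρ a * ρ b := eq_of_forall fun c => by
    rw [← φ_mul, ← mul_assoc, φ_mul b, ← mul_assoc, φ_mul a, mul_assoc]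
  exact ⟨.ofBijective (.ofLinearMap ρ ρ_one ρ_mul)
    ⟨ρ_injective, LinearMap.surjective_of_injective ρ_injective⟩, φ_mul⟩

variable [Ring A] [HopfAlgebra k A]

theorem IsRightIntegral.apply_smul_eq_apply_smul {φ : Module.Dual k A} (hφ : kerRightIdeal φ = ⊥)
    {t t' : A} (ht : IsRightIntegral k A t) (ht' : IsRightIntegral k A t') :
    φ t • t' = φ t' • t := by
  refine sub_eq_zero.1 ((Submodule.eq_bot_iff _).1 hφ _ (mem_kerRightIdeal.2 fun b => ?_))
  rw [sub_mul, smul_mul_assoc, smul_mul_assoc, ht, ht', map_sub, map_smul, map_smul, map_smul,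
    map_smul, smul_eq_mul, smul_eq_mul, smul_eq_mul, smul_eq_mul, mul_left_comm, sub_eq_zero]
  ring

theorem IsRightIntegral.apply_ne_zero {φ : Module.Dual k A} (hφ : kerRightIdeal φ = ⊥)
    {t : A} (ht : IsRightIntegral k A t) (ht₀ : t ≠ 0) : φ t ≠ 0 := fun h =>
  ht₀ ((Submodule.eq_bot_iff _).1 hφ _ (mem_kerRightIdeal.2 fun b => by
    rw [ht, map_smul, h, smul_zero]))

theorem IsRightIntegral.exists_modularElement {φ : Module.Dual k A} (hφ : kerRightIdeal φ = ⊥)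
    {t : A} (ht : IsRightIntegral k A t) (ht₀ : t ≠ 0) :
    ∃ α : A →ₐ[k] k, ∀ a, a * t = α a • t := by
  have smul_injective : Function.Injective fun c : k => c • t := smul_left_injective k ht₀
  let α : A →ₗ[k] k := (φ t)⁻¹ • φ ∘ₗ LinearMap.mulRight k t
  have mul_t (a : A) : a * t = α a • t := by
    have ht' : IsRightIntegral k A (a * t) := fun b => by rw [mul_assoc, ht, mul_smul_comm]
    have h := ht.apply_smul_eq_apply_smul hφ ht'
    rw [← inv_smul_smul₀ (ht.apply_ne_zero hφ ht₀) (a * t), h, smul_smul]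
    rfl
  refine ⟨.ofLinearMap α (smul_injective ?_) fun a b => smul_injective ?_, mul_t⟩
  · change α 1 • t = (1 : k) • t
    rw [← mul_t, one_mul, one_smul]
  · change α (a * b) • t = (α a * α b) • t
    rw [← mul_t, mul_assoc, mul_t b, mul_smul_comm, mul_t, smul_smul, mul_comm]

theorem nonempty_nakayamaData (k A : Type*) [Field k] [Ring A] [HopfAlgebra k A]
    [FiniteDimensional k A] : Nonempty (NakayamaData k A) := by
  obtain ⟨φ, hφ, hφ₀⟩ := exists_isDualRightIntegral_ne_zero k A
  obtain ⟨t, ht, ht₀⟩ := exists_isRightIntegral_ne_zero k A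
  have hφ_ker := hφ.kerRightIdeal_eq_bot hφ₀
  obtain ⟨ρ, hρ⟩ := exists_nakayamaAutomorphism hφ_ker
  obtain ⟨α, hα⟩ := ht.exists_modularElement hφ_ker ht₀
  exact ⟨⟨φ, hφ₀, hφ, ρ, hρ, t, ht₀, ht, α, hα⟩⟩

end Nakayama

section NakayamaEigenvectors

variable {k A : Type*} [Field k] [Ring A] [HopfAlgebra k A]

theorem antipode_eq_neg_antipode_mul_of_comul_eq {g x : A} (hg : IsGroupLikeElem k g)
    (hx : comul (R := k) x = g ⊗ₜ x + x ⊗ₜ 1) : antipode k x = -(antipode k g * x) := by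
  have counit_x : counit (R := k) x = 0 := by
    have h := rTensor_counit_comul (R := k) x
    rw [hx, map_add, LinearMap.rTensor_tmul, LinearMap.rTensor_tmul, hg.counit_eq_one,
      add_eq_left] at h
    have h' := congr(counit (R := k) (TensorProduct.lid k A $h))
    simpa using h'
  have h := mul_antipode_rTensor_comul_apply (R := k) x
  rw [hx, counit_x, map_add, map_add, LinearMap.rTensor_tmul, LinearMap.rTensor_tmul,
    LinearMap.mul'_apply, LinearMap.mul'_apply, mul_one, map_zero] at h
  exact eq_neg_of_add_eq_zero_right h

theorem algHom_apply_eq_zero_of_mul_eq_smul_mul (β : A →ₐ[k] k) {u x : A} (hu : IsUnit u) {q : k}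
    (hq : q ≠ 1) (h : u * x = q • (x * u)) : β x = 0 := by
  have h' : (1 - q) * (β u * β x) = 0 := by
    have := congr(β $h)
    rw [map_mul, map_smul, map_mul, smul_eq_mul] at this
    linear_combination this
  simpa [sub_eq_zero, hq.symm, (hu.map β).ne_zero] using h'

namespace NakayamaData

variable (N : NakayamaData k A)

theorem comul_mul_comul_t (a : A) :
    comul (R := k) a * comul (R := k) N.t = N.α a • comul (R := k) N.t := by
  rw [← Bialgebra.comul_mul, N.mul_t, map_smul]

theorem tmul_one_mul_comul_t {g : A} (hg : IsGroupLikeElem k g) :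
    g ⊗ₜ 1 * comul (R := k) N.t = N.α g • (1 ⊗ₜ antipode k g * comul (R := k) N.t) := by
  rw [← mul_smul_comm, ← comul_mul_comul_t, hg.comul_eq_tmul_self, ← mul_assoc,
    Algebra.TensorProduct.tmul_mul_tmul, one_mul, hg.antipode_mul_cancel]

theorem sliceLeft_comul_t : sliceLeft N.φ (comul N.t) = N.φ N.t • (1 : A) :=
  isDualRightIntegral_iff.1 N.φ_integral N.t

theorem ρ_eq_of_sliceLeft_eq {b c : A}
    (h : sliceLeft N.φ (c ⊗ₜ 1 * comul N.t) = N.φ N.t • antipode k b) : N.ρ b = c := by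
  have slice_eq : sliceLeft N.φ (c ⊗ₜ 1 * comul N.t) = sliceLeft N.φ (comul N.t * b ⊗ₜ 1) := by
    rw [h, N.t_integral.comul_mul_tmul_one, sliceLeft_mul_one_tmul, sliceLeft_comul_t,
      smul_mul_assoc, one_mul]
  rw [sliceLeft_tmul_one_mul, sliceLeft_mul_tmul_one] at slice_eq
  have functional_eq (v : A) : N.φ (c * v) = N.φ (v * b) :=
    congr($(N.t_integral.sliceLeft_comul_injective N.t_ne_zero slice_eq) v)
  refine sub_eq_zero.1 ((Submodule.eq_bot_iff _).1
    (N.φ_integral.kerRightIdeal_eq_bot N.φ_ne_zero) _ (mem_kerRightIdeal.2 fun v => ?_))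
  rw [sub_mul, map_sub, functional_eq, ← N.φ_mul, sub_self]

theorem smul_ρ_of_isGroupLikeElem {g : A} (hg : IsGroupLikeElem k g) : N.α g • N.ρ g = g := by
  rw [← map_smul]
  apply ρ_eq_of_sliceLeft_eq
  rw [tmul_one_mul_comul_t N hg, map_smul, sliceLeft_one_tmul_mul, sliceLeft_comul_t,
    mul_smul_comm, mul_one, map_smul, smul_comm]

theorem smul_ρ_of_comul_eq {g x : A} (hg : IsGroupLikeElem k g)
    (hx : comul (R := k) x = g ⊗ₜ x + x ⊗ₜ 1) {q : k} (hgx : g * x = q • (x * g))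
    (hαx : N.α x = 0) : (q * N.α g) • N.ρ x = x := by
  rw [← map_smul]
  apply ρ_eq_of_sliceLeft_eq
  have x_mul_antipode : x * antipode k g = q • (antipode k g * x) :=
    calc x * antipode k g = antipode k g * (g * x) * antipode k g := by
          rw [← mul_assoc, hg.antipode_mul_cancel, one_mul]
      _ = q • (antipode k g * x) := by
          rw [hgx, mul_smul_comm, smul_mul_assoc, mul_assoc, mul_assoc, hg.mul_antipode_cancel,
            mul_one]
  have x_tmul_one_mul : x ⊗ₜ 1 * comul (R := k) N.t
      = -(N.α g • (1 ⊗ₜ (x * antipode k g) * comul (R := k) N.t)) := by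
    have tmul_eq : g ⊗ₜ[k] x = 1 ⊗ₜ x * g ⊗ₜ 1 := by simp
    have h := N.comul_mul_comul_t x
    rw [hx, hαx, zero_smul, tmul_eq, add_mul, mul_assoc, tmul_one_mul_comul_t N hg,
      mul_smul_comm, ← mul_assoc, Algebra.TensorProduct.tmul_mul_tmul, one_mul] at h
    exact eq_neg_of_add_eq_zero_right h
  rw [x_tmul_one_mul, map_neg, map_smul, sliceLeft_one_tmul_mul, sliceLeft_comul_t, mul_smul_comm,
    mul_one, x_mul_antipode, map_smul, antipode_eq_neg_antipode_mul_of_comul_eq hg hx, smul_neg,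
    smul_neg, smul_smul, smul_smul, smul_smul]
  congr 2
  ring

end NakayamaData

end NakayamaEigenvectors

section Finiteness

variable {R A : Type*} [CommSemiring R] [Semiring A] [Algebra R A]

theorem finite_adjoin_range_monoidHom {M : Type*} [Monoid M] [Finite M] (f : M →* A) :
    Module.Finite R (Algebra.adjoin R (Set.range f)) := by
  have h : Subalgebra.toSubmodule (Algebra.adjoin R (Set.range f))
      = Submodule.span R (Set.range f) := by
    rw [Algebra.adjoin_eq_span, ← MonoidHom.coe_mrange, Submonoid.closure_eq]
  change Module.Finite R (Subalgebra.toSubmodule (Algebra.adjoin R (Set.range f)))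
  rw [h]
  exact Module.Finite.span_of_finite R (Set.finite_range f)

theorem exists_mul_eq_mul_add_of_mem_adjoin {S : Set A} {x : A}
    (h : ∀ s ∈ S, ∃ c ∈ Algebra.adjoin R S, ∃ d ∈ Algebra.adjoin R S, x * s = c * x + d) {b : A}
    (hb : b ∈ Algebra.adjoin R S) :
    ∃ c ∈ Algebra.adjoin R S, ∃ d ∈ Algebra.adjoin R S, x * b = c * x + d := by
  induction hb using Algebra.adjoin_induction with
  | mem s hs => exact h s hs
  | algebraMap r =>
    exact ⟨_, Subalgebra.algebraMap_mem _ r, 0, zero_mem _, by rw [add_zero, Algebra.commutes]⟩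
  | add a b _ _ ha hb =>
    obtain ⟨c, hc, d, hd, ha⟩ := ha
    obtain ⟨c', hc', d', hd', hb⟩ := hb
    exact ⟨c + c', add_mem hc hc', d + d', add_mem hd hd', by
      rw [mul_add, ha, hb, add_mul, add_add_add_comm]⟩
  | mul a b _ hb' ha hb =>
    obtain ⟨c, hc, d, hd, ha⟩ := ha
    obtain ⟨c', hc', d', hd', hb⟩ := hb
    exact ⟨c * c', mul_mem hc hc', c * d' + d * b, add_mem (mul_mem hc hd') (mul_mem hd hb'), by
      rw [← mul_assoc, ha, add_mul, mul_assoc, hb, mul_add, mul_assoc, add_assoc]⟩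

theorem toSubmodule_adjoin_le {S : Set A} {N : Submodule R A} (one_mem : 1 ∈ N)
    (mul_mem : ∀ s ∈ S, ∀ v ∈ N, s * v ∈ N) : Subalgebra.toSubmodule (Algebra.adjoin R S) ≤ N := by
  rw [Algebra.adjoin_eq_span, Submodule.span_le]
  exact fun a ha => Submonoid.closure_induction_left (motive := fun a _ => a ∈ N) one_mem
    (fun s hs v _ => mul_mem s hs v) ha

theorem toSubmodule_sup_adjoin_singleton {B : Subalgebra R A} {x : A} {m : ℕ} (hm : 0 < m)
    (hx : x ^ m ∈ B) (hxB : ∀ b ∈ B, ∃ c ∈ B, ∃ d ∈ B, x * b = c * x + d) :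
    Subalgebra.toSubmodule (B ⊔ Algebra.adjoin R {x}) =
      ⨆ j : Fin m, (Subalgebra.toSubmodule B).map (LinearMap.mulRight R (x ^ (j : ℕ))) := by
  set N := ⨆ j : Fin m, (Subalgebra.toSubmodule B).map (LinearMap.mulRight R (x ^ (j : ℕ)))
  have mul_pow_mem {b : A} (hb : b ∈ B) {j : ℕ} (hj : j < m) : b * x ^ j ∈ N :=
    Submodule.mem_iSup_of_mem ⟨j, hj⟩ ⟨b, hb, rfl⟩
  have mem_of_mem {b : A} (hb : b ∈ B) : b ∈ N := by simpa using mul_pow_mem hb hm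
  have mul_mem_of_forall {a : A} (ha : ∀ b ∈ B, ∀ j < m, a * (b * x ^ j) ∈ N) {v : A}
      (hv : v ∈ N) : a * v ∈ N := by
    have le_comap : N ≤ N.comap (LinearMap.mulLeft R a) := iSup_le fun j => by
      rintro _ ⟨b, hb, rfl⟩
      exact ha b hb j j.2
    exact le_comap hv
  have x_mul_mem (b : A) (hb : b ∈ B) (j : ℕ) (hj : j < m) : x * (b * x ^ j) ∈ N := by
    obtain ⟨c, hc, d, hd, h⟩ := hxB b hb
    rw [← mul_assoc, h, add_mul, mul_assoc, ← pow_succ']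
    refine add_mem ?_ (mul_pow_mem hd hj)
    rcases (Nat.succ_le_of_lt hj).lt_or_eq with hj | rfl
    · exact mul_pow_mem hc hj
    · exact mem_of_mem (mul_mem hc hx)
  refine le_antisymm ?_ (iSup_le fun j => ?_)
  · rw [← Algebra.adjoin_eq B, ← Algebra.adjoin_union]
    refine toSubmodule_adjoin_le (mem_of_mem B.one_mem) ?_
    rintro a (ha | rfl)
    · exact fun v => mul_mem_of_forall fun b hb j hj => by
        rw [← mul_assoc]
        exact mul_pow_mem (mul_mem ha hb) hj
    · exact fun v => mul_mem_of_forall x_mul_mem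
  · rintro _ ⟨b, hb, rfl⟩
    exact (B ⊔ Algebra.adjoin R {x}).mul_mem (le_sup_left (a := B) hb)
      (pow_mem (le_sup_right (a := B) (Algebra.self_mem_adjoin_singleton R x)) _)

theorem finite_sup_adjoin_singleton {B : Subalgebra R A} [hB : Module.Finite R B] {x : A} {m : ℕ}
    (hm : 0 < m) (hx : x ^ m ∈ B) (hxB : ∀ b ∈ B, ∃ c ∈ B, ∃ d ∈ B, x * b = c * x + d) :
    Module.Finite R ↥(B ⊔ Algebra.adjoin R {x}) := by
  change Module.Finite R (Subalgebra.toSubmodule (B ⊔ Algebra.adjoin R {x}))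
  rw [toSubmodule_sup_adjoin_singleton hm hx hxB, Module.Finite.iff_fg]
  exact Submodule.fg_iSup _ fun j =>
    (Module.Finite.iff_fg (N := Subalgebra.toSubmodule B).1 hB).map _

end Finiteness

namespace Datum

variable {k : Type*} [Field k] {G : Type*} [CommGroup G] {n : ℕ} (D : Datum k G n)

theorem adjoin_range_of_union_range_x :
    Algebra.adjoin k (Set.range D.of ∪ Set.range D.x) = ⊤ := by
  refine (Algebra.eq_top_iff).2 fun h => ?_
  induction h using D.induction with
  | halg c => exact Subalgebra.algebraMap_mem _ c
  | hof a => exact Algebra.subset_adjoin (.inl ⟨a, rfl⟩)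
  | hx i => exact Algebra.subset_adjoin (.inr ⟨i, rfl⟩)
  | hmul a b ha hb => exact mul_mem ha hb
  | hadd a b ha hb => exact add_mem ha hb

theorem exists_x_mul_eq_mul_x_add {s : Finset (Fin n)} {i : Fin n} (hi : i ∉ s) {b : D.H}
    (hb : b ∈ Algebra.adjoin k (Set.range D.of ∪ D.x '' s)) :
    ∃ c ∈ Algebra.adjoin k (Set.range D.of ∪ D.x '' s),
      ∃ d ∈ Algebra.adjoin k (Set.range D.of ∪ D.x '' s), D.x i * b = c * D.x i + d := by
  have of_mem (a : G) : D.of a ∈ Algebra.adjoin k (Set.range D.of ∪ D.x '' s) :=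
    Algebra.subset_adjoin (.inl ⟨a, rfl⟩)
  refine exists_mul_eq_mul_add_of_mem_adjoin ?_ hb
  rintro _ (⟨a, rfl⟩ | ⟨j, hj, rfl⟩)
  · refine ⟨_, Subalgebra.smul_mem _ (of_mem a) (D.χ i a⁻¹ : k), 0, zero_mem _, ?_⟩
    rw [add_zero, smul_mul_assoc]
    simpa only [inv_inv] using D.x_mul_of_inv a⁻¹ i
  · have hij : i ≠ j := fun h => hi (h ▸ hj)
    refine ⟨_, Subalgebra.smul_mem _ (Algebra.subset_adjoin (.inr ⟨j, hj, rfl⟩)) (D.q i j : k), _,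
      Subalgebra.smul_mem _ (sub_mem (one_mem _) (of_mem (D.g i * D.g j))) (D.lamm i j), ?_⟩
    rw [smul_mul_assoc, D.x_mul_x i j hij]

variable [Finite G]

theorem finite_adjoin_range_of_union_image_x (s : Finset (Fin n)) :
    Module.Finite k (Algebra.adjoin k (Set.range D.of ∪ D.x '' s)) := by
  induction s using Finset.induction_on with
  | empty =>
    rw [Finset.coe_empty, Set.image_empty, Set.union_empty]
    exact finite_adjoin_range_monoidHom D.of
  | insert i s hi ih =>
    rw [Finset.coe_insert, Set.image_insert_eq, Set.union_insert, Set.insert_eq, Set.union_comm,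
      Algebra.adjoin_union]
    refine finite_sup_adjoin_singleton (D.m_pos i) ?_ fun b => D.exists_x_mul_eq_mul_x_add hi
    rw [D.x_pow]
    exact Subalgebra.smul_mem _
      (sub_mem (one_mem _) (Algebra.subset_adjoin (.inl ⟨D.g i ^ D.m i, rfl⟩))) _

instance finiteDimensional : FiniteDimensional k D.H := by
  have h := D.finite_adjoin_range_of_union_image_x Finset.univ
  rw [Finset.coe_univ, Set.image_univ, adjoin_range_of_union_range_x] at h
  exact Module.Finite.equiv (Subalgebra.topEquiv (R := k) (A := D.H)).toLinearEquiv

end Datum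

theorem isDecomposition_iff {k A L : Type*} [Field k] [Ring A] [Algebra k A]
    {𝒜 : L → Submodule k A} : IsDecomposition k 𝒜 ↔ iSupIndep 𝒜 ∧ ⨆ l, 𝒜 l = ⊤ := by
  classical
  exact DirectSum.isInternal_submodule_iff_iSupIndep_and_iSup_eq_top 𝒜

section Graded

variable {k A L : Type*} [Field k] [Ring A] [Algebra k A] [Group L] {𝒜 : L → Submodule k A}
  {B : Subalgebra k A}

/-- `𝒜` is a grading of the algebra `A` by the group `L`. Mathlib's `GradedAlgebra` is indexed by an
additive monoid, whereas the gradings of this file are indexed by multiplicative groups. -/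
structure IsGraded (𝒜 : L → Submodule k A) : Prop where
  isDecomposition : IsDecomposition k 𝒜
  one_mem : 1 ∈ 𝒜 1
  mul_mem : ∀ {l l' a b}, a ∈ 𝒜 l → b ∈ 𝒜 l' → a * b ∈ 𝒜 (l * l')

namespace IsGraded

theorem mul_le (h𝒜 : IsGraded 𝒜) (l l' : L) : 𝒜 l * 𝒜 l' ≤ 𝒜 (l * l') :=
  Submodule.mul_le.2 fun _ ha _ hb => h𝒜.mul_mem ha hb

theorem isStronglyGraded_iff (h𝒜 : IsGraded 𝒜) :
    IsStronglyGraded k 𝒜 ↔ ∀ l, 1 ∈ 𝒜 l * 𝒜 l⁻¹ := by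
  refine ⟨fun h l => ?_, fun h => ⟨h𝒜.isDecomposition, fun l l' => (h𝒜.mul_le l l').antisymm ?_⟩⟩
  · rw [h.2, mul_inv_cancel]
    exact h𝒜.one_mem
  · calc 𝒜 (l * l') = 1 * 𝒜 (l * l') := (one_mul _).symm
      _ ≤ 𝒜 l * 𝒜 l⁻¹ * 𝒜 (l * l') := mul_le_mul_left (Submodule.one_le.2 (h l)) _
      _ = 𝒜 l * (𝒜 l⁻¹ * 𝒜 (l * l')) := mul_assoc _ _ _
      _ ≤ 𝒜 l * 𝒜 l' := by
        refine mul_le_mul_right ((h𝒜.mul_le _ _).trans_eq ?_) _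
        rw [inv_mul_cancel_left]

theorem exists_mem_apply_ne_zero (h𝒜 : IsGraded 𝒜) (h : IsStronglyGraded k 𝒜) (ε : A →ₐ[k] k)
    (l : L) : ∃ a ∈ 𝒜 l, ε a ≠ 0 := by
  by_contra! hε
  have le_ker : 𝒜 l * 𝒜 l⁻¹ ≤ LinearMap.ker ε.toLinearMap :=
    Submodule.mul_le.2 fun a ha b _ => by simp [hε a ha]
  simpa using le_ker (h𝒜.isStronglyGraded_iff.1 h l)

theorem isStronglyGraded_of_isCrossedProduct (h𝒜 : IsGraded 𝒜) (h : IsCrossedProduct k B 𝒜) :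
    IsStronglyGraded k 𝒜 := by
  obtain ⟨C, Φ, Φ_mul, Φ_coe, Φ_mem⟩ := h
  refine h𝒜.isStronglyGraded_iff.2 fun l => ?_
  have h := Φ_mul ((C.σ l l⁻¹)⁻¹ : Bˣ) 1 l l⁻¹
  rw [map_one, mul_one, Units.inv_mul, mul_inv_cancel, map_one, Φ_coe, OneMemClass.coe_one] at h
  rw [← h]
  exact Submodule.mul_mem_mul (Φ_mem _ _) (Φ_mem _ _)

theorem units_inv_mem (h𝒜 : IsGraded 𝒜) {u : Aˣ} {l : L} (hu : (u : A) ∈ 𝒜 l) :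
    ((u⁻¹ : Aˣ) : A) ∈ 𝒜 l⁻¹ := by
  obtain ⟨independent, iSup_eq_top⟩ := isDecomposition_iff.1 h𝒜.isDecomposition
  -- `u` maps each `𝒜 (l⁻¹ * m)` into `𝒜 m`; since the images span `A`, they are all of `𝒜 m`.
  have map_eq : (fun m => (𝒜 (l⁻¹ * m)).map (LinearMap.mulLeft k (u : A))) = 𝒜 := by
    refine (independent.le_iff_eq_of_iSup_eq_top ?_).1 fun m => ?_
    · rw [← Submodule.map_iSup, show ⨆ m, 𝒜 (l⁻¹ * m) = ⨆ m, 𝒜 m from (Equiv.mulLeft l⁻¹).iSup_comp,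
        iSup_eq_top, Submodule.map_top, LinearMap.range_eq_top]
      exact fun a => ⟨u⁻¹ * a, u.mul_inv_cancel_left a⟩
    · rintro _ ⟨a, ha, rfl⟩
      simpa using h𝒜.mul_mem hu ha
  obtain ⟨a, ha, hua : u * a = 1⟩ := congr(1 ∈ $map_eq 1).mpr h𝒜.one_mem
  rw [mul_one] at ha
  rwa [Units.inv_eq_of_mul_eq_one_right hua]

theorem conj_mem (h𝒜 : IsGraded 𝒜) (hB : Subalgebra.toSubmodule B = 𝒜 1) {u : L → Aˣ}
    (hu : ∀ l, (u l : A) ∈ 𝒜 l) (l : L) (b : B) :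
    u l * (b : A) * ((u l)⁻¹ : Aˣ) ∈ B := by
  rw [← Subalgebra.mem_toSubmodule, hB]
  have hb : (b : A) ∈ 𝒜 1 := hB ▸ b.2
  simpa using h𝒜.mul_mem (h𝒜.mul_mem (hu l) hb) (h𝒜.units_inv_mem (hu l))

theorem mul_mul_inv_mem (h𝒜 : IsGraded 𝒜) (hB : Subalgebra.toSubmodule B = 𝒜 1) {u : L → Aˣ}
    (hu : ∀ l, (u l : A) ∈ 𝒜 l) (l l' : L) :
    ((u l * u l' * (u (l * l'))⁻¹ : Aˣ) : A) ∈ B := by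
  rw [← Subalgebra.mem_toSubmodule, hB]
  simpa using h𝒜.mul_mem (h𝒜.mul_mem (hu l) (hu l')) (h𝒜.units_inv_mem (hu (l * l')))

theorem mul_mul_inv_inv_mem (h𝒜 : IsGraded 𝒜) (hB : Subalgebra.toSubmodule B = 𝒜 1) {u : L → Aˣ}
    (hu : ∀ l, (u l : A) ∈ 𝒜 l) (l l' : L) :
    (((u l * u l' * (u (l * l'))⁻¹)⁻¹ : Aˣ) : A) ∈ B := by
  rw [← Subalgebra.mem_toSubmodule, hB, ← inv_one]
  refine h𝒜.units_inv_mem ?_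
  rw [← hB]
  exact h𝒜.mul_mul_inv_mem hB hu l l'

variable (h𝒜 : IsGraded 𝒜) (hB : Subalgebra.toSubmodule B = 𝒜 1) {u : L → Aˣ}
  (hu : ∀ l, (u l : A) ∈ 𝒜 l)

/-- Conjugation by the homogeneous unit `u l`, as an endomorphism of the component of degree `1`. -/
def conj (l : L) : B →ₐ[k] B :=
  ((MulSemiringAction.toAlgHom k A (ConjAct.toConjAct (u l))).comp B.val).codRestrict B
    (h𝒜.conj_mem hB hu l)

@[simp] theorem coe_conj (l : L) (b : B) :
    (h𝒜.conj hB hu l b : A) = u l * (b : A) * ((u l)⁻¹ : Aˣ) :=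
  rfl

/-- The crossed system of a choice `u` of homogeneous units of all degrees: `L` acts by
conjugation by `u`, and `σ` measures the failure of `u` to be multiplicative. -/
def crossedSystem (hu_one : u 1 = 1) : CrossedSystem k B L where
  act := h𝒜.conj hB hu
  σ l l' :=
    { val := ⟨_, h𝒜.mul_mul_inv_mem hB hu l l'⟩
      inv := ⟨_, h𝒜.mul_mul_inv_inv_mem hB hu l l'⟩
      val_inv := Subtype.ext (Units.mul_inv (u l * u l' * (u (l * l'))⁻¹))
      inv_val := Subtype.ext (Units.inv_mul (u l * u l' * (u (l * l'))⁻¹)) }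
  act_one b := Subtype.ext (by simp [hu_one])
  σ_one_left l := Units.ext (Subtype.ext (by simp [hu_one]))
  σ_one_right l := Units.ext (Subtype.ext (by simp [hu_one]))
  twisted l l' b := Subtype.ext (by simp [mul_assoc])
  cocycle l l' l'' := Subtype.ext (by simp [mul_assoc])

/-- Multiplication by a homogeneous unit of degree `l` identifies the component of degree `1` with
the component of degree `l`. -/
def mulRightEquiv {v : Aˣ} {l : L} (hv : (v : A) ∈ 𝒜 l) : B ≃ₗ[k] 𝒜 l where
  toFun b := ⟨b * v, by simpa using h𝒜.mul_mem (hB ▸ b.2 : (b : A) ∈ 𝒜 1) hv⟩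
  map_add' b b' := Subtype.ext (add_mul _ _ _)
  map_smul' c b := Subtype.ext (smul_mul_assoc _ _ _)
  invFun a := ⟨a * (v⁻¹ : Aˣ), by
    rw [← Subalgebra.mem_toSubmodule, hB]
    simpa using h𝒜.mul_mem a.2 (h𝒜.units_inv_mem hv)⟩
  left_inv b := Subtype.ext (by simp)
  right_inv a := Subtype.ext (by simp)

open scoped Classical in
/-- The linear isomorphism from `B ⊗ k L` onto `A` that maps `b ⊗ l` to `b * u l`. -/
def tensorEquiv : B ⊗[k] MonoidAlgebra k L ≃ₗ[k] A :=
  TensorProduct.equivFinsuppOfBasisRight (MonoidAlgebra.basis L k) ≪≫ₗ finsuppLequivDFinsupp k ≪≫ₗ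
    DFinsupp.mapRange.linearEquiv (fun l => h𝒜.mulRightEquiv hB (hu l)) ≪≫ₗ
    LinearEquiv.ofBijective (DirectSum.coeLinearMap 𝒜) h𝒜.isDecomposition

theorem tensorEquiv_tmul_of (b : B) (l : L) :
    h𝒜.tensorEquiv hB hu (b ⊗ₜ MonoidAlgebra.of k L l) = b * u l := by
  classical
  have repr_of : (MonoidAlgebra.basis L k).repr (MonoidAlgebra.of k L l) = Finsupp.single l 1 :=
    (MonoidAlgebra.basis L k).repr_self l
  have basis_tmul : TensorProduct.equivFinsuppOfBasisRight (MonoidAlgebra.basis L k)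
      (b ⊗ₜ[k] MonoidAlgebra.of k L l) = Finsupp.single l b := by
    rw [TensorProduct.equivFinsuppOfBasisRight_apply_tmul, repr_of, Finsupp.mapRange_single,
      one_smul]
  change DirectSum.coeLinearMap 𝒜 (DFinsupp.mapRange.linearEquiv
    (fun l => h𝒜.mulRightEquiv hB (hu l)) (Finsupp.toDFinsupp
      (TensorProduct.equivFinsuppOfBasisRight (MonoidAlgebra.basis L k) _))) = _
  rw [basis_tmul, Finsupp.toDFinsupp_single, DFinsupp.mapRange.linearEquiv_apply,
    DFinsupp.mapRange_single]
  exact DirectSum.coeLinearMap_of 𝒜 l _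

theorem isCrossedProduct_of_units_mem (h𝒜 : IsGraded 𝒜) (hB : Subalgebra.toSubmodule B = 𝒜 1)
    (h : ∀ l, ∃ v : Aˣ, (v : A) ∈ 𝒜 l) : IsCrossedProduct k B 𝒜 := by
  classical
  obtain ⟨u, hu, hu_one⟩ : ∃ u : L → Aˣ, (∀ l, (u l : A) ∈ 𝒜 l) ∧ u 1 = 1 := by
    choose v hv using h
    refine ⟨Function.update v 1 1, fun l => ?_, Function.update_self ..⟩
    obtain rfl | hl := eq_or_ne l 1
    · simpa using h𝒜.one_mem
    · simpa [hl] using hv l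
  refine ⟨h𝒜.crossedSystem hB hu hu_one, h𝒜.tensorEquiv hB hu, fun b b' l l' => ?_, fun b => ?_,
    fun b l => ?_⟩
  · simp only [tensorEquiv_tmul_of]
    simp [crossedSystem, mul_assoc]
  · rw [← map_one (MonoidAlgebra.of k L), tensorEquiv_tmul_of, hu_one, Units.val_one, mul_one]
  · rw [tensorEquiv_tmul_of]
    exact (h𝒜.mulRightEquiv hB (hu l) b).2

end IsGraded

end Graded

section Eigenspace

open Module.End

variable {k A : Type*} [Field k] [Ring A] [Algebra k A] {ρ : A ≃ₐ[k] A}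

theorem mul_mem_eigenspace {c c' : k} {a b : A} (ha : a ∈ eigenspace ρ.toLinearMap c)
    (hb : b ∈ eigenspace ρ.toLinearMap c') : a * b ∈ eigenspace ρ.toLinearMap (c * c') := by
  simp only [mem_eigenspace_iff, AlgEquiv.toLinearMap_apply] at ha hb ⊢
  rw [map_mul, ha, hb, smul_mul_smul_comm]

theorem isGraded_eigenspace {L : Subgroup kˣ} {S : Set A} (hS : Algebra.adjoin k S = ⊤)
    (hSL : ∀ s ∈ S, ∃ ω ∈ L, ρ s = ω • s) :
    IsGraded fun ω : L => eigenspace ρ.toLinearMap ((ω : kˣ) : k) := by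
  have one_mem : (1 : A) ∈ eigenspace ρ.toLinearMap (((1 : L) : kˣ) : k) := by simp
  have iSup_eq_top : ⨆ ω : L, eigenspace ρ.toLinearMap ((ω : kˣ) : k) = ⊤ := by
    rw [eq_top_iff, ← Algebra.top_toSubmodule, ← hS]
    refine toSubmodule_adjoin_le (Submodule.mem_iSup_of_mem 1 one_mem) fun s hs v hv => ?_
    obtain ⟨ω, hω, ρ_s⟩ := hSL s hs
    have s_mem : s ∈ eigenspace ρ.toLinearMap (ω : k) := mem_eigenspace_iff.2 ρ_s
    suffices (⨆ ω : L, eigenspace ρ.toLinearMap ((ω : kˣ) : k)) ≤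
        (⨆ ω : L, eigenspace ρ.toLinearMap ((ω : kˣ) : k)).comap (LinearMap.mulLeft k s) from
      this hv
    refine iSup_le fun ω' v hv => ?_
    have mul_mem : s * v ∈ eigenspace ρ.toLinearMap (((⟨ω, hω⟩ * ω' : L) : kˣ) : k) :=
      mul_mem_eigenspace s_mem hv
    exact Submodule.mem_iSup_of_mem (p := fun ω : L => eigenspace ρ.toLinearMap ((ω : kˣ) : k)) _
      mul_mem
  have independent : iSupIndep fun ω : L => eigenspace ρ.toLinearMap ((ω : kˣ) : k) :=
    (eigenspaces_iSupIndep ρ.toLinearMap).comp (f := fun ω : L => ((ω : kˣ) : k))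
      (Units.val_injective.comp Subtype.val_injective)
  exact ⟨isDecomposition_iff.2 ⟨independent, iSup_eq_top⟩, one_mem, mul_mem_eigenspace⟩

theorem pow_apply_of_apply_eq_smul {c : k} {a : A} (h : ρ a = c • a) (d : ℕ) :
    (ρ ^ d) a = c ^ d • a := by
  induction d with
  | zero => simp
  | succ d ih => rw [pow_succ, AlgEquiv.mul_apply, h, map_smul, ih, smul_smul, pow_succ']

theorem pow_eq_one_of_isStronglyGraded_eigenspace {L : Subgroup kˣ}
    (h𝒜 : IsGraded fun ω : L => eigenspace ρ.toLinearMap ((ω : kˣ) : k))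
    (h : IsStronglyGraded k fun ω : L => eigenspace ρ.toLinearMap ((ω : kˣ) : k))
    {ε : A →ₐ[k] k} {d : ℕ} (hε : ∀ a, ε ((ρ ^ d) a) = ε a) {ω : kˣ} (hω : ω ∈ L) :
    ω ^ d = 1 := by
  obtain ⟨a, ha, εa_ne_zero⟩ := h𝒜.exists_mem_apply_ne_zero h ε ⟨ω, hω⟩
  have := hε a
  rw [pow_apply_of_apply_eq_smul (mem_eigenspace_iff.1 ha), map_smul, smul_eq_mul,
    mul_eq_right₀ εa_ne_zero] at this
  exact Units.ext (by simpa using this)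

end Eigenspace

theorem mem_of_pow_card_eq_one {k : Type*} [Field k] {L : Subgroup kˣ} [Finite L] {ω : kˣ}
    (h : ω ^ Nat.card L = 1) : ω ∈ L := by
  have : NeZero (Nat.card L) := ⟨Nat.card_pos.ne'⟩
  have le_rootsOfUnity : L ≤ rootsOfUnity (Nat.card L) k := fun y hy =>
    (mem_rootsOfUnity _ _).2 (congr_arg Subtype.val (pow_card_eq_one' (x := (⟨y, hy⟩ : L))))
  rw [Subgroup.eq_of_le_of_card_ge le_rootsOfUnity (card_rootsOfUnity k _)]
  exact (mem_rootsOfUnity _ _).2 h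

namespace Datum

variable {k : Type*} [Field k] {G : Type*} [CommGroup G] [Finite G] {n : ℕ}
  (D : Datum k G n)

theorem isGroupLikeElem_of (a : G) : IsGroupLikeElem k (D.of a) where
  counit_eq_one := D.counitHom_of a
  comul_eq_tmul_self := D.comulHom_of a

theorem comul_x (i : Fin n) :
    comul (R := k) (D.x i) = D.of (D.g i) ⊗ₜ[k] D.x i + D.x i ⊗ₜ[k] 1 :=
  D.comulHom_x i

theorem algHom_apply_x (β : D.H →ₐ[k] k) (i : Fin n) : β (D.x i) = 0 :=
  algHom_apply_eq_zero_of_mul_eq_smul_mul β ((Group.isUnit (D.g i)).map D.of)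
    (Units.val_eq_one.not.2 (D.χ_self_ne_one i)) (D.of_mul_x (D.g i) i)

section NakayamaData

variable (N : NakayamaData k D.H)

theorem ρ_of (a : G) : N.ρ (D.of a) = (D.αG N a)⁻¹ • D.of a := by
  rw [eq_inv_smul_iff]
  exact N.smul_ρ_of_isGroupLikeElem (D.isGroupLikeElem_of a)

theorem ρ_x (i : Fin n) : N.ρ (D.x i) = (D.q i i * D.αG N (D.g i))⁻¹ • D.x i := by
  rw [eq_inv_smul_iff]
  exact N.smul_ρ_of_comul_eq (D.isGroupLikeElem_of (D.g i)) (D.comul_x i) (D.of_mul_x (D.g i) i)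
    (D.algHom_apply_x N.α i)

theorem L₂_le_L₁ : D.L₂ N ≤ D.L₁ N := by
  rintro _ ⟨a, rfl⟩
  exact Subgroup.subset_closure (Or.inr ⟨a, rfl⟩)

theorem isGraded_component : IsGraded (D.component N) := by
  refine isGraded_eigenspace D.adjoin_range_of_union_range_x ?_
  rintro _ (⟨a, rfl⟩ | ⟨i, rfl⟩)
  · exact ⟨_, inv_mem (D.L₂_le_L₁ N ⟨a, rfl⟩), D.ρ_of N a⟩
  · exact ⟨_, inv_mem (mul_mem (Subgroup.subset_closure (Or.inl ⟨i, rfl⟩))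
      (D.L₂_le_L₁ N ⟨D.g i, rfl⟩)), D.ρ_x N i⟩

theorem toSubmodule_componentOne :
    Subalgebra.toSubmodule (D.componentOne N) = D.component N 1 := by
  ext h
  simp [componentOne, component, AlgHom.mem_equalizer]

theorem counit_ρ_pow_card (h : D.H) :
    D.counitHom ((N.ρ ^ Nat.card (D.L₂ N)) h) = D.counitHom h := by
  suffices D.counitHom.comp (N.ρ ^ Nat.card (D.L₂ N)).toAlgHom = D.counitHom from
    DFunLike.congr_fun this h
  refine D.algHom_ext (fun a => ?_) fun i => by simp only [algHom_apply_x]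
  have αG_pow : D.αG N a ^ Nat.card (D.L₂ N) = 1 :=
    congr_arg Subtype.val (pow_card_eq_one' (x := (⟨D.αG N a, a, rfl⟩ : D.L₂ N)))
  change D.counitHom ((N.ρ ^ _) (D.of a)) = _
  rw [pow_apply_of_apply_eq_smul (D.ρ_of N a), ← Units.val_pow_eq_pow_val, inv_pow, αG_pow]
  simp

theorem L₁_eq_L₂_of_isStronglyGraded (h : IsStronglyGraded k (D.component N)) :
    D.L₁ N = D.L₂ N := by
  have : Finite (D.L₂ N) := (Set.finite_range (D.αG N)).to_subtype
  refine le_antisymm (fun ω hω => mem_of_pow_card_eq_one ?_) (D.L₂_le_L₁ N)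
  exact pow_eq_one_of_isStronglyGraded_eigenspace (D.isGraded_component N) h
    (D.counit_ρ_pow_card N) hω

theorem exists_of_mem_component_of_L₁_eq_L₂ (h : D.L₁ N = D.L₂ N) (ω : D.L₁ N) :
    ∃ a : G, D.of a ∈ D.component N ω := by
  obtain ⟨a, ha⟩ : (ω : kˣ) ∈ D.L₂ N := h ▸ ω.2
  refine ⟨a⁻¹, Module.End.mem_eigenspace_iff.2 ?_⟩
  rw [← ha, ← inv_inv (D.αG N a), ← map_inv]
  exact D.ρ_of N a⁻¹

theorem isCrossedProduct_of_forall_exists_of_mem_component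
    (h : ∀ ω : D.L₁ N, ∃ a : G, D.of a ∈ D.component N ω) :
    IsCrossedProduct k (D.componentOne N) (D.component N) := by
  refine (D.isGraded_component N).isCrossedProduct_of_units_mem (D.toSubmodule_componentOne N)
    fun ω => ?_
  obtain ⟨a, ha⟩ := h ω
  exact ⟨D.of.toHomUnits a, ha⟩

end NakayamaData

end Datum

end QLS

end

theorem mainTheorem1 {k : Type*} [Field k] {G : Type*} [CommGroup G] [Finite G] {n : ℕ}
    (D : QLS.Datum k G n) :
    Nonempty (QLS.NakayamaData k D.H) ∧
    ∀ N : QLS.NakayamaData k D.H,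
      QLS.IsDecomposition k (D.component N) ∧
      List.TFAE [
        QLS.IsStronglyGraded k (D.component N),
        ∀ ω : D.L₁ N, ∃ a : G, D.of a ∈ D.component N ω,
        D.L₁ N = D.L₂ N,
        QLS.IsCrossedProduct k (D.componentOne N) (D.component N)] := by
  refine ⟨QLS.nonempty_nakayamaData k D.H, fun N => ⟨(D.isGraded_component N).isDecomposition, ?_⟩⟩
  tfae_have 1 → 3 := D.L₁_eq_L₂_of_isStronglyGraded N
  tfae_have 3 → 2 := D.exists_of_mem_component_of_L₁_eq_L₂ N
  tfae_have 2 → 4 := D.isCrossedProduct_of_forall_exists_of_mem_component N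
  tfae_have 4 → 1 := (D.isGraded_component N).isStronglyGraded_of_isCrossedProduct
  tfae_finish
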